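/- Let $R$ be an associative ring with identity. A right $R$-module $M$ is called automorphism-invariant if $g(M)\subseteq M$ for every automorphism $g$ of its injective hull $E(M)$. A submodule of a module is called closed if it has no proper essential extension in that module. A ring $T$ is called right square-free if the right module $T_T$ does not contain a direct sum of two nonzero isomorphic submodules. Suppose that every cyclic right $R$-module is automorphism-invariant. Then $R\cong S\times T$ as rings, where $S$ is a semisimple artinian ring and $T$ is a right square-free ring such that $\operatorname{Hom}_T(X,Y)=0$ for any two closed right ideals $X$ and $Y$ of $T$ with $X\cap Y=0$. In particular, all idempotents of $T$ are central. -/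

import Mathlib

/-! Right modules over a ring `R` are modules over the opposite ring `Rᵐᵒᵖ`; the right regular
module `R_R` is `R` with its standard `Rᵐᵒᵖ`-module structure, and right ideals of `R` are
terms of `Submodule Rᵐᵒᵖ R`. The module notions are defined for modules over any ring `A`. -/

universe u v

section ModuleNotions

variable {A : Type u} [Ring A] {M : Type v} [AddCommGroup M] [Module A M]

/-- `N` is an essential extension of `K` inside the ambient module: `K ≤ N`, and every submodule
of `N` that meets `K` trivially is zero. -/
def EssentialIn (K N : Submodule A M) : Prop :=
  K ≤ N ∧ ∀ L : Submodule A M, L ≤ N → L ⊓ K = ⊥ → L = ⊥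

/-- A submodule is closed if it has no proper essential extension in the ambient module. -/
def IsClosedSubmodule (K : Submodule A M) : Prop :=
  ∀ N : Submodule A M, EssentialIn K N → N = K

variable (A M) in
/-- A module is square-free if it does not contain a direct sum of two nonzero isomorphic
submodules. -/
def IsSquareFreeModule : Prop :=
  ¬ ∃ X Y : Submodule A M, X ≠ ⊥ ∧ Y ≠ ⊥ ∧ X ⊓ Y = ⊥ ∧ Nonempty (X ≃ₗ[A] Y)

/-- The embedding `i : M → E` presents `E` as an injective hull of `M`: `E` is injective and
is an essential extension of the image of `M`. -/
def IsInjectiveHull {E : Type (max u v)} [AddCommGroup E] [Module A E] (i : M →ₗ[A] E) : Prop :=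
  Function.Injective i ∧ Module.Injective A E ∧ EssentialIn (LinearMap.range i) ⊤

variable (A M) in
/-- A module is automorphism-invariant if it is invariant under every automorphism of its
injective hull (which is unique up to an isomorphism over `M`). -/
def IsAutomorphismInvariant : Prop :=
  ∀ (E : Type (max u v)) [AddCommGroup E] [Module A E] (i : M →ₗ[A] E), IsInjectiveHull i →
    ∀ g : E ≃ₗ[A] E, ∀ m : M, g (i m) ∈ LinearMap.range i

variable (A M) in
/-- A module is cyclic if it is generated by one element. -/
def IsCyclicModule : Prop :=
  ∃ x : M, Submodule.span A {x} = ⊤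

end ModuleNotions

/-! Write `N` for the right module `R`; every quotient of `N` is automorphism-invariant.

The basic tool is `IsAutomorphismInvariant.exists_matrixUnits`. If an automorphism-invariant module
`M` contains two independent copies of a module, they extend to two independent isomorphic summands
of the injective hull of `M`. The off-diagonal maps between these summands square to zero, so adding
`1` to them gives automorphisms, which preserve `M`. Hence `M` itself has off-diagonal matrix units
`a`, `b`, and splits off the isomorphic summands `range (b ∘ a)` and `range (a ∘ b)`. By the same
trick the summands of an automorphism-invariant direct sum are injective relative to each other.

*Squares in `N` are semisimple.* If `a`, `b` are matrix units of `N` and `P = range (b ∘ a)`, every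
quotient of `P` and of its complement is injective relative to `P`. Therefore the finitely generated
submodules of `P` are summands, and Osofsky's argument
(`not_iSupIndep_of_forall_relInjective_quotient`) excludes infinite independent families in `P`.
Given an independent family indexed by `ℕ × ℕ` with sum `I`, relative injectivity of `P / I`
yields an endomorphism of `P` that is the identity modulo `I` on the summand belonging to any row,
and maps into `I` the summand belonging to any set of indices that meets each row in a finite set;
choosing one index far out in each row contradicts this. Zorn's lemma gives a maximal pair of
independent isomorphic submodules, contained in `P` and its partner. Together with the largest image
of `P` in their complement these form a semisimple summand. The rest is square-free, and there are
no nonzero maps between the two parts. So the projections are central idempotents, and `R = S × T`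
(`QuotientsAutInvariant.exists_central_idempotent`).

*Independent right ideals of `T`.* Let now `N` be the square-free summand, which is `T` as a right
`R`-module. Any two endomorphisms `s`, `t` satisfy `s t - t c ∈ Z` for some `c`, where `Z` consists
of the endomorphisms with essential kernel, and `1 - z` is onto for `z ∈ Z`. A projective `N` with
these properties has no quotient `V × V` with `V ≠ 0`: if `p`, `q` are the coordinates of
`N → V × V`, write `q = p s`, and lift `(0, q) : N → V × V` to an endomorphism `t` of `N`; then
`q = p (s t - t c)` and `p = q y` give `p (1 - z y) = 0` with `z ∈ Z`, so `p = 0`. Finally, let `f : X → Y` be a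
map between independent submodules of `N`. The quotient `N / ker f` contains two independent copies
of the image of `f`, inside `X / ker f` and `Y`; the matrix units of this quotient give a quotient
`V × V` of `N`, so `f = 0`. Idempotents of `T` are central because `x ↦ (1 - e) s x` maps `eT` to
`(1 - e)T`. -/

/-! ### Essential extensions, injective hulls and matrix units -/

section Essential

variable {A : Type u} [Ring A] {M : Type v} [AddCommGroup M] [Module A M]

theorem essentialIn_iff {K N : Submodule A M} :
    EssentialIn K N ↔ K ≤ N ∧ ∀ x ∈ N, x ≠ 0 → ∃ r : A, r • x ∈ K ∧ r • x ≠ 0 := by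
  refine and_congr_right fun _ ↦ ⟨fun h x hx hx0 ↦ ?_, fun h L hL hLK ↦ ?_⟩
  · by_contra! hr
    refine hx0 ?_
    have := h (Submodule.span A {x}) (by simpa [Submodule.span_le] using hx) ?_
    · simpa using this
    · rw [eq_bot_iff]
      rintro y ⟨hy, hyK⟩
      obtain ⟨r, rfl⟩ := Submodule.mem_span_singleton.1 hy
      exact hr r hyK
  · rw [eq_bot_iff]
    intro x hx
    by_contra hx0
    obtain ⟨r, hr, hr0⟩ := h x (hL hx) hx0
    exact hr0 ((Submodule.mem_bot A).1 (hLK ▸ ⟨L.smul_mem r hx, hr⟩))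

theorem EssentialIn.trans {K L N : Submodule A M} (h : EssentialIn K L) (h' : EssentialIn L N) :
    EssentialIn K N := by
  rw [essentialIn_iff] at *
  refine ⟨h.1.trans h'.1, fun x hx hx0 ↦ ?_⟩
  obtain ⟨r, hr, hr0⟩ := h'.2 x hx hx0
  obtain ⟨s, hs, hs0⟩ := h.2 _ hr hr0
  exact ⟨s * r, by rwa [mul_smul], by rwa [mul_smul]⟩

/-- Zorn's lemma for a condition on pairs of elements of a submodule. -/
theorem Submodule.exists_maximal_of_forall (P : M → M → Prop) (K₀ : Submodule A M)
    (h₀ : ∀ x ∈ K₀, ∀ y ∈ K₀, P x y) :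
    ∃ K, K₀ ≤ K ∧ (∀ x ∈ K, ∀ y ∈ K, P x y) ∧
      ∀ K', K ≤ K' → (∀ x ∈ K', ∀ y ∈ K', P x y) → K' = K := by
  have hz := zorn_le_nonempty₀ {K : Submodule A M | ∀ x ∈ K, ∀ y ∈ K, P x y} ?_ K₀ h₀
  · obtain ⟨K, hK, hmax⟩ := hz
    exact ⟨K, hK, hmax.1, fun K' hle hK' ↦ le_antisymm (hmax.2 hK' hle) hle⟩
  · intro c hc hchain K hK
    have hmem : ∀ {x}, x ∈ sSup c ↔ ∃ L ∈ c, x ∈ L :=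
      Submodule.mem_sSup_of_directed ⟨K, hK⟩ hchain.directedOn
    refine ⟨sSup c, fun x hx y hy ↦ ?_, fun L hL ↦ le_sSup hL⟩
    obtain ⟨L, hL, hxL⟩ := hmem.1 hx
    obtain ⟨L', hL', hyL⟩ := hmem.1 hy
    rcases hchain.total hL hL' with h | h
    · exact hc hL' x (h hxL) y hyL
    · exact hc hL x hxL y (h hyL)

/-- A complement of `V` in the sense of closed submodules: a submodule that is maximal among those
meeting `V` trivially. -/
theorem Submodule.exists_maximal_disjoint (V : Submodule A M) :
    ∃ K, Disjoint V K ∧ ∀ K', K ≤ K' → Disjoint V K' → K' = K := by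
  obtain ⟨K, -, hK, hmax⟩ := Submodule.exists_maximal_of_forall (A := A)
    (fun x _ : M ↦ x ∈ V → x = 0) ⊥ (by simp)
  refine ⟨K, Submodule.disjoint_def.2 fun x hx hx' ↦ hK x hx' x hx' hx, fun K' hle hK' ↦
    hmax K' hle fun x hx _ _ hxV ↦ Submodule.disjoint_def.1 hK' x hxV hx⟩

/-- If `K` is maximal among the submodules meeting `V` trivially, then every element outside `K`
has a multiple that differs from a nonzero element of `V` by an element of `K`. -/
theorem Submodule.exists_smul_add_mem_of_maximal_disjoint {V K : Submodule A M}
    (hmax : ∀ K', K ≤ K' → Disjoint V K' → K' = K) {x : M} (hx : x ∉ K) :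
    ∃ r : A, ∃ k ∈ K, k + r • x ∈ V ∧ k + r • x ≠ 0 := by
  by_contra! h
  refine hx ?_
  rw [← hmax (K ⊔ Submodule.span A {x}) le_sup_left ?_]
  · exact Submodule.mem_sup_right (Submodule.mem_span_singleton_self x)
  · rw [Submodule.disjoint_def]
    intro y hyV hy
    obtain ⟨k, hk, z, hz, rfl⟩ := Submodule.mem_sup.1 hy
    obtain ⟨r, rfl⟩ := Submodule.mem_span_singleton.1 hz
    exact h r k hk hyV

/-- `V` is a direct summand: some endomorphism maps into `V` and is the identity on `V`. -/
def Submodule.HasProjection (V : Submodule A M) : Prop :=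
  ∃ ρ : M →ₗ[A] M, (∀ x, ρ x ∈ V) ∧ ∀ x ∈ V, ρ x = x

end Essential

section Hull

variable {A : Type u} [Ring A]

theorem Module.Injective.exists_extension {X Y E : Type u} [AddCommGroup X] [Module A X]
    [AddCommGroup Y] [Module A Y] [AddCommGroup E] [Module A E] (hE : Module.Injective A E)
    (q : X →ₗ[A] Y) (hq : Function.Injective q) (f : X →ₗ[A] E) :
    ∃ g : Y →ₗ[A] E, ∀ x, g (q x) = f x :=
  hE.out q hq f

theorem LinearMap.exists_comp_eq_of_injective {X Y E : Type*} [AddCommGroup X] [Module A X]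
    [AddCommGroup Y] [Module A Y] [AddCommGroup E] [Module A E] (i : X →ₗ[A] E)
    (hi : Function.Injective i) (h : Y →ₗ[A] E) (hr : ∀ y, h y ∈ LinearMap.range i) :
    ∃ g : Y →ₗ[A] X, ∀ y, i (g y) = h y := by
  refine ⟨(LinearEquiv.ofInjective i hi).symm.toLinearMap ∘ₗ h.codRestrict _ hr, fun y ↦ ?_⟩
  have := (LinearEquiv.ofInjective i hi).apply_symm_apply (h.codRestrict _ hr y)
  exact congrArg Subtype.val this

variable {E : Type u} [AddCommGroup E] [Module A E]

theorem Submodule.HasProjection.injective {V : Submodule A E} (hV : V.HasProjection)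
    (hE : Module.Injective A E) : Module.Injective A V := by
  obtain ⟨ρ, hρ, hρ'⟩ := hV
  refine ⟨fun X Y _ _ _ _ q hq f ↦ ?_⟩
  obtain ⟨g, hg⟩ := hE.out q hq (V.subtype ∘ₗ f)
  refine ⟨ρ.codRestrict V hρ ∘ₗ g, fun x ↦ Subtype.ext ?_⟩
  simp [hg, hρ']

/-- In an injective module every submodule is essential in a direct summand. -/
theorem Module.Injective.exists_essentialIn_hasProjection (hE : Module.Injective A E)
    (U : Submodule A E) : ∃ V : Submodule A E, EssentialIn U V ∧ V.HasProjection := by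
  obtain ⟨V, hUV, hV, hVmax⟩ := Submodule.exists_maximal_of_forall (A := A)
    (fun x _ : E ↦ x ≠ 0 → ∃ r : A, r • x ∈ U ∧ r • x ≠ 0) U
    (fun x hx _ _ hx0 ↦ ⟨1, by simpa using hx, by simpa using hx0⟩)
  have hess : EssentialIn U V := essentialIn_iff.2 ⟨hUV, fun x hx ↦ hV x hx x hx⟩
  refine ⟨V, hess, ?_⟩
  obtain ⟨K, hK, hKmax⟩ := V.exists_maximal_disjoint
  obtain ⟨φ, hφ⟩ := hE.exists_extension (K.mkQ ∘ₗ V.subtype) (by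
    rw [← LinearMap.ker_eq_bot, eq_bot_iff]
    intro x hx
    have hxK : (x : E) ∈ K := by simpa using hx
    exact Subtype.ext (Submodule.disjoint_def.1 hK x x.2 hxK)) V.subtype
  simp only [LinearMap.comp_apply, Submodule.subtype_apply] at hφ
  have hφV : ∀ x ∈ V, φ (K.mkQ x) = x := fun x hx ↦ hφ ⟨x, hx⟩
  have hVr : V ≤ LinearMap.range φ := fun x hx ↦ ⟨_, hφV x hx⟩
  have hVess : EssentialIn V (LinearMap.range φ) := by
    refine essentialIn_iff.2 ⟨hVr, ?_⟩
    rintro _ ⟨y, rfl⟩ hy0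
    obtain ⟨x, rfl⟩ := K.mkQ_surjective y
    have hxK : x ∉ K := fun h ↦ hy0 (by
      have hx0 : K.mkQ x = 0 := by simpa using h
      rw [hx0, map_zero])
    obtain ⟨r, k, hk, hV', hne⟩ := Submodule.exists_smul_add_mem_of_maximal_disjoint hKmax hxK
    have hk0 : K.mkQ k = 0 := by simpa using hk
    have : r • φ (K.mkQ x) = k + r • x := by
      rw [← hφV _ hV', map_add, hk0, zero_add, map_smul, map_smul]
    exact ⟨r, this ▸ hV', this ▸ hne⟩
  have hr : LinearMap.range φ = V :=
    hVmax _ hVr fun x hx _ _ ↦ (essentialIn_iff.1 (hess.trans hVess)).2 x hx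
  exact ⟨φ ∘ₗ K.mkQ, fun x ↦ hr ▸ LinearMap.mem_range_self φ _, hφV⟩

theorem exists_isInjectiveHull (A : Type u) [Ring A] (M : Type u) [AddCommGroup M] [Module A M] :
    ∃ (E : Type u) (_ : AddCommGroup E) (_ : Module A E) (i : M →ₗ[A] E), IsInjectiveHull i := by
  let J := (CategoryTheory.EnoughInjectives.presentation (ModuleCat.of A M)).some
  have hJ : Module.Injective A J.J :=
    Module.injective_module_of_injective_object A J.J (inj := J.injective)
  have hf : Function.Injective J.f.hom := (ModuleCat.mono_iff_injective J.f).1 J.mono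
  obtain ⟨V, hV, hVp⟩ := hJ.exists_essentialIn_hasProjection (LinearMap.range J.f.hom)
  refine ⟨V, inferInstance, inferInstance,
    J.f.hom.codRestrict V fun x ↦ hV.1 (LinearMap.mem_range_self _ x), ?_, hVp.injective hJ, ?_⟩
  · exact fun x y h ↦ hf (congrArg Subtype.val h)
  · rw [essentialIn_iff] at hV ⊢
    refine ⟨le_top, fun x _ hx0 ↦ ?_⟩
    obtain ⟨r, ⟨m, hm⟩, hr0⟩ := hV.2 x x.2 (by simpa using hx0)
    exact ⟨r, ⟨m, Subtype.ext hm⟩, fun h ↦ hr0 (congrArg Subtype.val h)⟩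

/-- `X` is injective relative to `Y`: maps into `X` extend from submodules of `Y` to `Y`. -/
def RelInjective (A : Type u) [Ring A] (X Y : Type*) [AddCommGroup X] [Module A X]
    [AddCommGroup Y] [Module A Y] : Prop :=
  ∀ (L : Submodule A Y) (f : L →ₗ[A] X), ∃ g : Y →ₗ[A] X, ∀ x : L, g x = f x

theorem RelInjective.exists_extension {X Y Z : Type*} [AddCommGroup X] [Module A X]
    [AddCommGroup Y] [Module A Y] [AddCommGroup Z] [Module A Z] (h : RelInjective A X Y)
    (q : Z →ₗ[A] Y) (hq : Function.Injective q) (f : Z →ₗ[A] X) :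
    ∃ g : Y →ₗ[A] X, ∀ z, g (q z) = f z := by
  obtain ⟨g, hg⟩ := h (LinearMap.range q) (f ∘ₗ (LinearEquiv.ofInjective q hq).symm.toLinearMap)
  refine ⟨g, fun z ↦ ?_⟩
  simpa using hg (LinearEquiv.ofInjective q hq z)

theorem RelInjective.of_injective {X Y Z : Type*} [AddCommGroup X] [Module A X]
    [AddCommGroup Y] [Module A Y] [AddCommGroup Z] [Module A Z] (h : RelInjective A X Y)
    (q : Z →ₗ[A] Y) (hq : Function.Injective q) : RelInjective A X Z := fun L f ↦ by
  obtain ⟨g, hg⟩ := h.exists_extension (q ∘ₗ L.subtype) (hq.comp L.injective_subtype) f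
  exact ⟨g ∘ₗ q, hg⟩

theorem RelInjective.of_equiv_left {X Y Z : Type*} [AddCommGroup X] [Module A X]
    [AddCommGroup Y] [Module A Y] [AddCommGroup Z] [Module A Z] (h : RelInjective A X Y)
    (e : Z ≃ₗ[A] X) : RelInjective A Z Y := fun L f ↦ by
  obtain ⟨g, hg⟩ := h L (e.toLinearMap ∘ₗ f)
  exact ⟨e.symm.toLinearMap ∘ₗ g, fun x ↦ by simp [hg]⟩

/-- The automorphism `1 + α` attached to an endomorphism `α` with `α ^ 2 = 0`. -/
def LinearEquiv.oneAddOfSqZero {M : Type*} [AddCommGroup M] [Module A M] (α : M →ₗ[A] M)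
    (hα : ∀ x, α (α x) = 0) : M ≃ₗ[A] M :=
  LinearEquiv.ofLinearMap (LinearMap.id + α) (LinearMap.id - α)
    (by ext x; simp [hα]) (by ext x; simp [hα])

variable {M X Y : Type u} [AddCommGroup M] [Module A M] [AddCommGroup X] [Module A X]
  [AddCommGroup Y] [Module A Y]

theorem IsAutomorphismInvariant.sqZero_mem_range (hM : IsAutomorphismInvariant A M) {i : M →ₗ[A] E}
    (hi : IsInjectiveHull i) (α : E →ₗ[A] E) (hα : ∀ x, α (α x) = 0) (m : M) :
    α (i m) ∈ LinearMap.range i := by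
  have h := hM E i hi (LinearEquiv.oneAddOfSqZero α hα) m
  have h' : α (i m) = LinearEquiv.oneAddOfSqZero α hα (i m) - i m := by
    simp [LinearEquiv.oneAddOfSqZero]
  rw [h']
  exact Submodule.sub_mem _ h (LinearMap.mem_range_self i m)

/-- The complementary summands of an automorphism-invariant module are relatively injective:
a map between the hulls of the summands is the off-diagonal entry of a unipotent automorphism. -/
theorem relInjective_of_isAutomorphismInvariant_prod (h : IsAutomorphismInvariant A (X × Y)) :
    RelInjective A X Y := by
  intro L f
  obtain ⟨E, _, _, i, hi, hE, hEe⟩ := exists_isInjectiveHull A X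
  obtain ⟨F, _, _, j, hj, hF, hFe⟩ := exists_isInjectiveHull A Y
  rw [essentialIn_iff] at hEe hFe
  have hull : IsInjectiveHull (i.prodMap j) := by
    refine ⟨hi.prodMap hj, ⟨fun P Q _ _ _ _ q hq f ↦ ?_⟩, essentialIn_iff.2 ⟨le_top, ?_⟩⟩
    · obtain ⟨g₁, h₁⟩ := hE.out q hq (LinearMap.fst A E F ∘ₗ f)
      obtain ⟨g₂, h₂⟩ := hF.out q hq (LinearMap.snd A E F ∘ₗ f)
      exact ⟨g₁.prod g₂, fun x ↦ Prod.ext (h₁ x) (h₂ x)⟩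
    · rintro ⟨a, b⟩ - hab
      have key : ∀ a : E, a ≠ 0 → ∀ y : Y, ∃ r : A, r • (a, j y) ∈ LinearMap.range (i.prodMap j) ∧
          r • (a, j y) ≠ 0 := by
        intro a ha y
        obtain ⟨r, ⟨x, hx⟩, hr0⟩ := hEe.2 a trivial ha
        exact ⟨r, ⟨(x, r • y), Prod.ext hx (by simp)⟩, fun h ↦ hr0 (congrArg Prod.fst h)⟩
      by_cases hb : b = 0
      · subst hb
        simpa using key a (fun h ↦ hab (by simp [h])) 0
      · obtain ⟨r, ⟨y, hy⟩, hr0⟩ := hFe.2 b trivial hb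
        by_cases hra : r • a = 0
        · exact ⟨r, ⟨(0, y), Prod.ext (by simp [hra]) hy⟩, fun h ↦ hr0 (congrArg Prod.snd h)⟩
        · obtain ⟨s, hs, hs0⟩ := key (r • a) hra y
          have : (s * r) • (a, b) = s • (r • a, j y) := by rw [hy, mul_smul]; rfl
          exact ⟨s * r, this ▸ hs, this ▸ hs0⟩
  obtain ⟨k, hk⟩ := hE.exists_extension (j ∘ₗ L.subtype) (hj.comp L.injective_subtype) (i ∘ₗ f)
  have hkr : ∀ y, (k ∘ₗ j) y ∈ LinearMap.range i := by
    intro y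
    obtain ⟨⟨x, y'⟩, h'⟩ := h.sqZero_mem_range hull
      (LinearMap.inl A E F ∘ₗ k ∘ₗ LinearMap.snd A E F) (by simp) (0, y)
    exact ⟨x, by simpa using congrArg Prod.fst h'⟩
  obtain ⟨g, hg⟩ := LinearMap.exists_comp_eq_of_injective i hi _ hkr
  exact ⟨g, fun x ↦ hi (by simpa [hg] using hk x)⟩

/-- If an automorphism-invariant module contains two independent copies of `X`, then its
endomorphism ring contains a pair of off-diagonal `2 × 2` matrix units `a`, `b` that exchange the
two copies. The matrix units come from the injective hull: there the copies extend to isomorphic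
independent summands, and a square-zero endomorphism `α` of the hull preserves the module because
`1 + α` is an automorphism. -/
theorem IsAutomorphismInvariant.exists_matrixUnits (hM : IsAutomorphismInvariant A M)
    (p q : X →ₗ[A] M) (hp : Function.Injective p) (hq : Function.Injective q)
    (hpq : Disjoint (LinearMap.range p) (LinearMap.range q)) :
    ∃ a b : M →ₗ[A] M, (∀ x, a (a x) = 0) ∧ (∀ x, b (b x) = 0) ∧ (∀ x, a (b (a x)) = a x) ∧
      (∀ x, b (a (b x)) = b x) ∧ ∀ x, a (p x) = q x ∧ b (q x) = p x := by
  obtain ⟨E, _, _, i, hull⟩ := exists_isInjectiveHull A M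
  obtain ⟨hi, hE, -⟩ := id hull
  obtain ⟨V, hV, hVp⟩ := hE.exists_essentialIn_hasProjection (LinearMap.range (i ∘ₗ p))
  rw [essentialIn_iff] at hV
  obtain ⟨hpV, hV⟩ := hV
  let p' : X →ₗ[A] V := (i ∘ₗ p).codRestrict V fun x ↦ hpV (LinearMap.mem_range_self _ x)
  have hp'v : ∀ x, (p' x : E) = i (p x) := fun x ↦ rfl
  obtain ⟨φ, hφ⟩ := hE.exists_extension p'
    (fun x y h ↦ hp (hi (congrArg Subtype.val h))) (i ∘ₗ q)
  have hVx : ∀ v : V, v ≠ 0 → ∃ r : A, ∃ x, r • v = p' x ∧ r • v ≠ 0 := by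
    intro v hv
    obtain ⟨r, ⟨x, hx⟩, hr0⟩ := hV v v.2 (by simpa using hv)
    exact ⟨r, x, Subtype.ext hx.symm, fun h ↦ hr0 (congrArg Subtype.val h)⟩
  have hφi : ∀ v, φ v = 0 → v = 0 := by
    intro v hv
    by_contra hv0
    obtain ⟨r, x, hx, hr0⟩ := hVx v hv0
    have h1 : i (q x) = 0 := by
      have := hφ x
      rw [← hx, map_smul, hv, smul_zero] at this
      exact this.symm
    have h2 : x = 0 := hq (hi (by simpa using h1))
    exact hr0 (by rw [hx, h2, map_zero])
  have hdisj : ∀ v w : V, (v : E) = φ w → v = 0 := by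
    intro v w hvw
    by_contra hv0
    obtain ⟨r, x, hx, hr0⟩ := hVx v hv0
    have hrw : r • w ≠ 0 := fun h ↦ hr0 (Subtype.ext (by
      simp only [Submodule.coe_smul, hvw, ← map_smul, h, map_zero, Submodule.coe_zero]))
    obtain ⟨s, y, hy, hs0⟩ := hVx _ hrw
    have h1 : i (p (s • x)) = i (q y) := by
      have h3 : φ (s • r • w) = i (q y) := by rw [hy]; exact hφ y
      rw [← h3, map_smul φ, map_smul φ, ← hvw, ← Submodule.coe_smul, hx, hp'v, map_smul, map_smul]
    have h2 : q y = 0 := Submodule.disjoint_def.1 hpq _ ⟨s • x, hi h1⟩ ⟨y, rfl⟩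
    have h4 : y = 0 := hq (by simpa using h2)
    exact hs0 (by rw [hy, h4, map_zero])
  have hVinj := hVp.injective hE
  have hcop : Function.Injective (V.subtype.coprod φ) := by
    rw [← LinearMap.ker_eq_bot, eq_bot_iff]
    rintro ⟨v, w⟩ hvw
    have hvw' : (v : E) + φ w = 0 := by simpa using hvw
    have hv : v = 0 := hdisj v (-w) (by rw [map_neg]; exact eq_neg_of_add_eq_zero_left hvw')
    subst hv
    have hw : w = 0 := hφi w (by simpa using hvw')
    subst hw
    simp
  obtain ⟨π₁, hπ₁⟩ := hVinj.exists_extension _ hcop (LinearMap.fst A V V)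
  obtain ⟨π₂, hπ₂⟩ := hVinj.exists_extension _ hcop (LinearMap.snd A V V)
  have h11 : ∀ v : V, π₁ v = v := fun v ↦ by simpa using hπ₁ (v, 0)
  have h12 : ∀ v : V, π₁ (φ v) = 0 := fun v ↦ by simpa using hπ₁ (0, v)
  have h21 : ∀ v : V, π₂ v = 0 := fun v ↦ by simpa using hπ₂ (v, 0)
  have h22 : ∀ v : V, π₂ (φ v) = v := fun v ↦ by simpa using hπ₂ (0, v)
  obtain ⟨a, ha⟩ := LinearMap.exists_comp_eq_of_injective i hi ((φ ∘ₗ π₁) ∘ₗ i)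
    (fun m ↦ hM.sqZero_mem_range hull (φ ∘ₗ π₁) (by simp [h12]) m)
  obtain ⟨b, hb⟩ := LinearMap.exists_comp_eq_of_injective i hi ((V.subtype ∘ₗ π₂) ∘ₗ i)
    (fun m ↦ hM.sqZero_mem_range hull (V.subtype ∘ₗ π₂) (by simp [h21]) m)
  simp only [LinearMap.comp_apply, Submodule.subtype_apply] at ha hb hφ
  refine ⟨a, b, fun x ↦ hi ?_, fun x ↦ hi ?_, fun x ↦ hi ?_, fun x ↦ hi ?_,
    fun x ↦ ⟨hi ?_, hi ?_⟩⟩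
  · simp [ha, h12]
  · simp [hb, h21]
  · simp [ha, hb, h11, h22]
  · simp [ha, hb, h11, h22]
  · rw [ha, ← hφ, ← hp'v, h11]
  · rw [hb, ← hφ, h22, hp'v]

end Hull

/-! ### Osofsky's theorem for projective modules -/

section Independence

theorem iSupIndep_nat_of_disjoint_lt {α : Type*} [CompleteLattice α] [IsCompactlyGenerated α]
    [IsModularLattice α] {f : ℕ → α} (h : ∀ n, Disjoint (f n) (⨆ k < n, f k)) : iSupIndep f := by
  have hr : ∀ n, (Finset.range n).SupIndep f := by
    intro n
    induction n with
    | zero => simp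
    | succ n ih =>
      rw [Finset.range_add_one]
      refine ih.insert ?_
      simpa [Finset.sup_eq_iSup] using h n
  refine iSupIndep_iff_supIndep.2 fun s ↦ ?_
  obtain ⟨n, hn⟩ := s.exists_nat_subset_range
  exact (hr n).subset hn

variable {A : Type*} [Ring A] {M : Type*} [AddCommGroup M] [Module A M]

theorem Submodule.HasProjection.isCompl {V : Submodule A M} (h : V.HasProjection) :
    ∃ W, IsCompl V W := by
  obtain ⟨ρ, h1, h2⟩ := h
  refine ⟨LinearMap.ker ρ, ?_, ?_⟩
  · exact Submodule.disjoint_def.2 fun x hx hx' ↦ by rw [← h2 x hx]; simpa using hx'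
  · rw [codisjoint_iff, eq_top_iff]
    intro x _
    rw [show x = ρ x + (x - ρ x) by abel]
    exact Submodule.add_mem_sup (h1 x) (by simp [h2 _ (h1 x)])

theorem Submodule.HasProjection.projective [Module.Projective A M] {V : Submodule A M}
    (h : V.HasProjection) : Module.Projective A V := by
  obtain ⟨ρ, h1, h2⟩ := h
  exact Module.Projective.of_split V.subtype (ρ.codRestrict V h1)
    (LinearMap.ext fun x ↦ Subtype.ext (h2 x x.2))

theorem Submodule.exists_iSupIndep_of_not_isSemisimpleModule
    (hs : ∀ N : Submodule A M, N.FG → N.HasProjection) (h : ¬ IsSemisimpleModule A M) :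
    ∃ D : ℕ → Submodule A M, iSupIndep D ∧ (∀ n, D n ≠ ⊥) ∧ ∀ n, (D n).FG := by
  obtain ⟨N, hN⟩ : ∃ N : Submodule A M, ¬ N.FG := by
    by_contra! hfg
    exact h { exists_isCompl := fun N ↦ (hs N (hfg N)).isCompl }
  have step : ∀ K : {K : Submodule A M // K.FG ∧ K ≤ N}, ∃ d ∈ N, d ≠ 0 ∧
      Disjoint (Submodule.span A {d}) K.1 := by
    rintro ⟨K, hK, hKN⟩
    obtain ⟨x, hxN, hxK⟩ : ∃ x ∈ N, x ∉ K :=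
      Set.not_subset.1 fun h ↦ hN (le_antisymm hKN h ▸ hK)
    obtain ⟨ρ, h1, h2⟩ := hs K hK
    refine ⟨x - ρ x, N.sub_mem hxN (hKN (h1 x)), fun h ↦ hxK (sub_eq_zero.1 h ▸ h1 x), ?_⟩
    rw [Submodule.disjoint_def]
    intro y hy hyK
    obtain ⟨r, rfl⟩ := Submodule.mem_span_singleton.1 hy
    rw [← h2 _ hyK, map_smul, map_sub, h2 _ (h1 x), sub_self, smul_zero]
  choose d hdN hd0 hdK using step
  let next : {K : Submodule A M // K.FG ∧ K ≤ N} → {K : Submodule A M // K.FG ∧ K ≤ N} := fun K ↦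
    ⟨K.1 ⊔ Submodule.span A {d K}, K.2.1.sup (Submodule.fg_span_singleton _),
      sup_le K.2.2 (by simpa [Submodule.span_le] using hdN K)⟩
  let S : ℕ → {K : Submodule A M // K.FG ∧ K ≤ N} := fun n ↦
    next^[n] ⟨⊥, Submodule.fg_bot, bot_le⟩
  have hS : ∀ n, (S (n + 1)).1 = (S n).1 ⊔ Submodule.span A {d (S n)} := fun n ↦ by
    simp only [S, Function.iterate_succ_apply']; rfl
  have hlt : ∀ n, ∀ k < n, Submodule.span A {d (S k)} ≤ (S n).1 := by
    intro n
    induction n with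
    | zero => simp
    | succ n ih =>
      intro k hk
      rw [hS]
      rcases Nat.lt_succ_iff_lt_or_eq.1 hk with h | rfl
      · exact (ih k h).trans le_sup_left
      · exact le_sup_right
  refine ⟨fun n ↦ Submodule.span A {d (S n)}, iSupIndep_nat_of_disjoint_lt fun n ↦ ?_,
    fun n ↦ by simpa using hd0 _, fun n ↦ Submodule.fg_span_singleton _⟩
  exact (hdK (S n)).mono_right (iSup₂_le (hlt n))

end Independence

section Osofsky

variable {A : Type u} [Ring A]

theorem RelInjective.quotient {X Y : Type*} [AddCommGroup X] [Module A X]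
    [AddCommGroup Y] [Module A Y] (h : RelInjective A X Y) (K : Submodule A Y) :
    RelInjective A X (Y ⧸ K) := by
  intro L f
  obtain ⟨g, hg⟩ := h (L.comap K.mkQ) (f ∘ₗ K.mkQ.restrict (q := L) fun x hx ↦ hx)
  refine ⟨K.liftQ g fun x hx ↦ ?_, ?_⟩
  · have hx0 : K.mkQ x = 0 := by simpa using hx
    have hxL : x ∈ L.comap K.mkQ := by simp [hx0]
    have h1 := hg ⟨x, hxL⟩
    rw [LinearMap.mem_ker]
    refine h1.trans ?_
    rw [LinearMap.comp_apply, show K.mkQ.restrict (q := L) (fun x hx ↦ hx) ⟨x, hxL⟩ = 0 from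
      Subtype.ext hx0, map_zero]
  · rintro ⟨y, hy⟩
    obtain ⟨x, rfl⟩ := K.mkQ_surjective y
    exact hg ⟨x, hy⟩

variable {P : Type v} [AddCommGroup P] [Module A P]

/-- If finitely generated submodules of a finitely generated projective module are summands, an
endomorphism with essential kernel vanishes. -/
theorem LinearMap.eq_zero_of_essential_ker [Module.Finite A P] [Module.Projective A P]
    (hs : ∀ N : Submodule A P, N.FG → N.HasProjection) (g : P →ₗ[A] P)
    (hg : EssentialIn (LinearMap.ker g) ⊤) : g = 0 := by
  have hr : (LinearMap.range g).HasProjection := hs _ (by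
    rw [LinearMap.range_eq_map]
    exact Module.Finite.fg_top.map g)
  have := hr.projective
  obtain ⟨s, h_s⟩ := Module.projective_lifting_property g.rangeRestrict LinearMap.id
    g.surjective_rangeRestrict
  have hs' : ∀ y, g.rangeRestrict (s y) = y := fun y ↦ LinearMap.congr_fun h_s y
  rw [essentialIn_iff] at hg
  ext x
  by_contra hx
  set y := g.rangeRestrict x with hy
  have hsy : s y ≠ 0 := fun h ↦ hx (by
    have h1 := hs' y
    rw [h, map_zero] at h1
    exact (congrArg Subtype.val h1).symm)
  obtain ⟨r, hr, hr0⟩ := hg.2 (s y) trivial hsy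
  apply hr0
  have h1 : r • y = 0 := by
    rw [← hs' y, ← map_smul]
    exact Subtype.ext hr
  rw [← map_smul, h1, map_zero]

theorem LinearMap.ext_of_maximal_disjoint [Module.Finite A P] [Module.Projective A P]
    (hs : ∀ N : Submodule A P, N.FG → N.HasProjection) {ι : Type*} {D : ι → Submodule A P}
    {K : Submodule A P} (hdisj : Disjoint (⨆ n, D n) K)
    (hK : ∀ K', K ≤ K' → Disjoint (⨆ n, D n) K' → K' = K) {f g : P →ₗ[A] P}
    (hD : ∀ n, ∀ x ∈ D n, f x = g x) (hfK : ∀ x ∈ K, f x = g x) : f = g := by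
  rw [← sub_eq_zero]
  refine LinearMap.eq_zero_of_essential_ker hs _ (essentialIn_iff.2 ⟨le_top, fun x _ hx0 ↦ ?_⟩)
  have hI : (⨆ n, D n) ≤ LinearMap.ker (f - g) :=
    iSup_le fun n x hx ↦ by simp [hD n x hx]
  have hK' : K ≤ LinearMap.ker (f - g) := fun x hx ↦ by simp [hfK x hx]
  by_cases hx : x ∈ K
  · exact ⟨1, by simpa using hK' hx, by simpa using hx0⟩
  · obtain ⟨r, k, hk, hmem, hne⟩ := Submodule.exists_smul_add_mem_of_maximal_disjoint hK hx
    refine ⟨r, ?_, fun hrx ↦ hne (Submodule.disjoint_def.1 hdisj _ hmem (by simpa [hrx] using hk))⟩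
    have := Submodule.sub_mem _ (hI hmem) (hK' hk)
    simpa using this

/-- A family of sets closed under unions defines, for endomorphisms `e B` that behave like the
projections onto partial sums, the submodule of all `y` lying in some `e B` up to `I`. -/
theorem Submodule.exists_mem_iff_of_union_closed {ι : Type*} (e : Set ι → P →ₗ[A] P)
    (he : ∀ B C x, e B (e C x) = e (B ∩ C) x) (I : Submodule A P)
    (heI : ∀ B, ∀ x ∈ I, e B x ∈ I) (F : Set (Set ι)) (h0 : ∅ ∈ F)
    (hF : ∀ B ∈ F, ∀ C ∈ F, B ∪ C ∈ F) :
    ∃ N : Submodule A P, ∀ y, y ∈ N ↔ ∃ B ∈ F, y - e B y ∈ I := by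
  have mono : ∀ B C y, y - e B y ∈ I → B ⊆ C → y - e C y ∈ I := by
    intro B C y hy hBC
    have h1 : e C (e B y) = e B y := by rw [he, Set.inter_eq_right.2 hBC]
    have h2 := I.sub_mem hy (heI C _ hy)
    rwa [map_sub, h1, show y - e B y - (e C y - e B y) = y - e C y by abel] at h2
  refine ⟨⟨⟨⟨{y | ∃ B ∈ F, y - e B y ∈ I}, ?_⟩, ⟨∅, h0, by simp⟩⟩, ?_⟩, fun y ↦ Iff.rfl⟩
  · rintro y z ⟨B, hB, hy⟩ ⟨C, hC, hz⟩
    refine ⟨B ∪ C, hF B hB C hC, ?_⟩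
    have := I.add_mem (mono _ (B ∪ C) _ hy Set.subset_union_left)
      (mono _ (B ∪ C) _ hz Set.subset_union_right)
    rwa [show y - e (B ∪ C) y + (z - e (B ∪ C) z) = y + z - e (B ∪ C) (y + z) by
      rw [map_add]; abel] at this
  · rintro r y ⟨B, hB, hy⟩
    exact ⟨B, hB, by simpa [smul_sub] using I.smul_mem r hy⟩

/-- Osofsky's argument. If every quotient of the finitely generated projective module `P` is
injective relative to `P` and its finitely generated submodules are summands, then `P` has no
infinite independent family of nonzero finitely generated submodules. -/
theorem not_iSupIndep_of_forall_relInjective_quotient [Module.Finite A P] [Module.Projective A P]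
    (hq : ∀ K : Submodule A P, RelInjective A (P ⧸ K) P)
    (hs : ∀ N : Submodule A P, N.FG → N.HasProjection) (D : ℕ × ℕ → Submodule A P)
    (hD : iSupIndep D) (hD0 : ∀ n, D n ≠ ⊥) (hDfg : ∀ n, (D n).FG) : False := by
  classical
  set I := ⨆ n, D n with hI
  obtain ⟨K, hK, hKmax⟩ := I.exists_maximal_disjoint
  have hPP : RelInjective A P P := (hq ⊥).of_equiv_left (Submodule.quotEquivOfEqBot ⊥ rfl).symm
  have hext : ∀ f g : P →ₗ[A] P, (∀ n, ∀ x ∈ D n, f x = g x) → (∀ x ∈ K, f x = g x) → f = g :=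
    fun f g ↦ LinearMap.ext_of_maximal_disjoint hs hK hKmax
  -- The projection of `I ⊕ K` onto the partial sum indexed by `B` extends to `P`.
  have hex : ∀ B : Set (ℕ × ℕ), ∃ e : P →ₗ[A] P, (∀ n ∈ B, ∀ x ∈ D n, e x = x) ∧
      (∀ n ∉ B, ∀ x ∈ D n, e x = 0) ∧ ∀ x ∈ K, e x = 0 := by
    intro B
    set V := ⨆ n ∈ B, D n
    set W := ⨆ n ∈ Bᶜ, D n
    have hVW : Disjoint V W := hD.disjoint_biSup_biSup disjoint_compl_right
    have hle : V ⊔ W ≤ I := sup_le (iSup₂_le fun n _ ↦ le_iSup D n) (iSup₂_le fun n _ ↦ le_iSup D n)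
    have hVWK : Disjoint V (W ⊔ K) :=
      hVW.disjoint_sup_right_of_disjoint_sup_left (hK.mono_left hle)
    obtain ⟨e, he⟩ := hPP.exists_extension (V.subtype.coprod (W ⊔ K).subtype) (by
      rw [← LinearMap.ker_eq_bot, eq_bot_iff]
      rintro ⟨v, w⟩ hvw
      have hvw' : (v : P) + w = 0 := by simpa using hvw
      have hv : v = 0 := Subtype.ext (Submodule.disjoint_def.1 hVWK v v.2 (by
        rw [eq_neg_of_add_eq_zero_left hvw']; exact neg_mem w.2))
      subst hv
      have hw : w = 0 := Subtype.ext (by simpa using hvw')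
      subst hw
      simp) (V.subtype ∘ₗ LinearMap.fst A V (W ⊔ K : Submodule A P))
    have heV : ∀ v ∈ V, e v = v := fun v hv ↦ by simpa using he (⟨v, hv⟩, 0)
    have heW : ∀ w ∈ W ⊔ K, e w = 0 := fun w hw ↦ by simpa using he (0, ⟨w, hw⟩)
    exact ⟨e, fun n hn x hx ↦ heV x ((le_iSup₂ (f := fun n (_ : n ∈ B) ↦ D n) n hn) hx),
      fun n hn x hx ↦ heW x (Submodule.mem_sup_left
        ((le_iSup₂ (f := fun n (_ : n ∈ Bᶜ) ↦ D n) n hn) hx)),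
      fun x hx ↦ heW x (Submodule.mem_sup_right hx)⟩
  choose e he1 he0 heK using hex
  have he : ∀ B C x, e B (e C x) = e (B ∩ C) x := by
    intro B C
    refine fun x ↦ LinearMap.congr_fun (f := e B ∘ₗ e C) (hext _ _ (fun n x hx ↦ ?_)
      fun x hx ↦ by simp [heK _ x hx]) x
    by_cases hC : n ∈ C
    · by_cases hB : n ∈ B
      · simp [he1 C n hC x hx, he1 B n hB x hx, he1 _ n (Set.mem_inter hB hC) x hx]
      · simp [he1 C n hC x hx, he0 B n hB x hx, he0 (B ∩ C) n (fun h ↦ hB h.1) x hx]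
    · simp [he0 C n hC x hx, he0 (B ∩ C) n (fun h ↦ hC h.2) x hx]
  have heI : ∀ B, ∀ x ∈ I, e B x ∈ I := by
    intro B
    change I ≤ I.comap (e B)
    refine iSup_le fun n x hx ↦ ?_
    by_cases hB : n ∈ B
    · simpa [he1 B n hB x hx] using (le_iSup D n) hx
    · simp [he0 B n hB x hx]
  have hfin : ∀ B : Set (ℕ × ℕ), B.Finite → ∀ x, e B x ∈ I := by
    intro B hB x
    obtain ⟨ρ, h1, h2⟩ := hs _ (Submodule.fg_biSup hB.toFinset D fun n _ ↦ hDfg n)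
    have : ρ ∘ₗ e B = e B := hext _ _ (fun n x hx ↦ by
      by_cases hn : n ∈ B
      · rw [LinearMap.comp_apply, he1 B n hn x hx, h2]
        exact (le_iSup₂ (f := fun n (_ : n ∈ hB.toFinset) ↦ D n) n (by simpa using hn)) hx
      · simp [he0 B n hn x hx]) fun x hx ↦ by simp [heK B x hx]
    rw [← this]
    exact (iSup₂_le fun n _ ↦ le_iSup D n : (⨆ n ∈ hB.toFinset, D n) ≤ I) (h1 _)
  -- Unions of finitely many rows, and sets that meet every row in a finite set.
  obtain ⟨N₁, hN₁⟩ := Submodule.exists_mem_iff_of_union_closed e he I heI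
    {B | (Prod.fst '' B).Finite} (by simp) (fun B hB C hC ↦ by
      simpa [Set.image_union] using And.intro hB hC)
  obtain ⟨N₂, hN₂⟩ := Submodule.exists_mem_iff_of_union_closed e he I heI
    {B | ∀ j, (B ∩ {p | p.1 = j}).Finite} (by simp) (fun B hB C hC j ↦ by
      rw [Set.union_inter_distrib_right]; exact (hB j).union (hC j))
  have hN : ∀ y ∈ N₁, y ∈ N₂ → y ∈ I := by
    intro y h1 h2
    obtain ⟨B, hB, hBy⟩ := (hN₁ y).1 h1
    obtain ⟨C, hC, hCy⟩ := (hN₂ y).1 h2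
    have hBC : (B ∩ C).Finite := by
      refine (hB.biUnion fun j _ ↦ hC j).subset fun p hp ↦ ?_
      simp only [Set.mem_iUnion]
      exact ⟨p.1, ⟨p, hp.1, rfl⟩, hp.2, rfl⟩
    have h3 := I.add_mem hBy (I.add_mem (heI B _ hCy) (hfin _ hBC y))
    rwa [map_sub, he, show y - e B y + (e B y - e (B ∩ C) y + e (B ∩ C) y) = y by abel] at h3
  -- The map that is the identity on `N₁` and zero on `N₂`, modulo `I`, is induced by an
  -- endomorphism `x` of `P`.
  obtain ⟨x, hx1, hx2⟩ : ∃ x : P →ₗ[A] P, (∀ y ∈ N₁, x y - y ∈ I) ∧ ∀ y ∈ N₂, x y ∈ I := by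
    let V := N₁.map I.mkQ
    let W := N₂.map I.mkQ
    have hVW : Disjoint V W := by
      rw [Submodule.disjoint_def]
      rintro _ ⟨y, hy, rfl⟩ ⟨z, hz, hzy⟩
      have hIz : z - y ∈ I := by
        rwa [← Submodule.Quotient.eq]
      have hyz : z - (z - y) ∈ N₂ := N₂.sub_mem hz ((hN₂ _).2 ⟨∅, by simp, by
        simpa using I.sub_mem hIz (heI ∅ _ hIz)⟩)
      rw [sub_sub_cancel] at hyz
      simpa using hN y hy hyz
    obtain ⟨π, hπ⟩ := ((hq I).quotient I).exists_extension (V.subtype.coprod W.subtype) (by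
      rw [← LinearMap.ker_eq_bot, eq_bot_iff]
      rintro ⟨v, w⟩ hvw
      have hvw' : (v : P ⧸ I) + w = 0 := by simpa using hvw
      have hv : v = 0 := Subtype.ext (Submodule.disjoint_def.1 hVW v v.2 (by
        rw [eq_neg_of_add_eq_zero_left hvw']; exact neg_mem w.2))
      subst hv
      have hw : w = 0 := Subtype.ext (by simpa using hvw')
      subst hw
      simp) (V.subtype ∘ₗ LinearMap.fst A V W)
    obtain ⟨x, hx⟩ := Module.projective_lifting_property I.mkQ (π ∘ₗ I.mkQ) I.mkQ_surjective
    have hx' : ∀ y, I.mkQ (x y) = π (I.mkQ y) := fun y ↦ LinearMap.congr_fun hx y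
    refine ⟨x, fun y hy ↦ ?_, fun y hy ↦ ?_⟩
    · have h1 : π (I.mkQ y) = I.mkQ y := by simpa using hπ (⟨_, y, hy, rfl⟩, 0)
      rw [← Submodule.Quotient.eq]
      exact (hx' y).trans h1
    · have h1 : π (I.mkQ y) = 0 := by simpa using hπ (0, ⟨_, y, hy, rfl⟩)
      rw [← Submodule.Quotient.mk_eq_zero]
      exact (hx' y).trans h1
  have hcpt : ∀ g : P →ₗ[A] P, (∀ y, g y ∈ I) → ∃ F : Finset (ℕ × ℕ), ∀ y, g y ∈ ⨆ n ∈ F, D n := by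
    intro g hg
    have hfg : (LinearMap.range g).FG := by
      rw [LinearMap.range_eq_map]
      exact Module.Finite.fg_top.map g
    obtain ⟨F, hF⟩ := CompleteLattice.IsCompactElement.exists_finset_of_le_iSup _
      ((Submodule.fg_iff_compact _).1 hfg) D (by
      rintro _ ⟨y, rfl⟩
      exact hg y)
    exact ⟨F, fun y ↦ hF ⟨y, rfl⟩⟩
  have hrow : ∀ j : ℕ, ∃ F : Finset (ℕ × ℕ), ∀ k, ∀ d ∈ D (j, k), x d - d ∈ ⨆ n ∈ F, D n := by
    intro j
    obtain ⟨F, hF⟩ := hcpt ((x - LinearMap.id) ∘ₗ e {p | p.1 = j}) fun y ↦ by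
      refine hx1 _ ((hN₁ _).2 ⟨{p | p.1 = j}, ?_, by simp [he]⟩)
      refine (Set.finite_singleton j).subset ?_
      rintro _ ⟨p, hp, rfl⟩
      exact hp
    refine ⟨F, fun k d hd ↦ ?_⟩
    have := hF d
    rwa [LinearMap.comp_apply, he1 {p | p.1 = j} (j, k) rfl d hd] at this
  choose F hF using hrow
  have hk : ∀ j, ∃ k, (j, k) ∉ F j := fun j ↦ by
    obtain ⟨k, hk⟩ := Infinite.exists_notMem_finset ((F j).image Prod.snd)
    exact ⟨k, fun h ↦ hk (Finset.mem_image_of_mem Prod.snd h)⟩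
  choose k hk using hk
  -- The diagonal set meets every row once, so `x` maps the corresponding summand into `I`.
  obtain ⟨G, hG⟩ := hcpt (x ∘ₗ e {p | p.2 = k p.1}) fun y ↦ by
    refine hx2 _ ((hN₂ _).2 ⟨{p | p.2 = k p.1}, fun j ↦ ?_, by simp [he]⟩)
    refine (Set.finite_singleton (j, k j)).subset ?_
    rintro ⟨a, b⟩ ⟨h1, rfl⟩
    simpa using h1
  obtain ⟨j, hj⟩ := Infinite.exists_notMem_finset (G.image Prod.fst)
  have hjG : (j, k j) ∉ G := fun h ↦ hj (Finset.mem_image_of_mem Prod.fst h)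
  obtain ⟨d, hd, hd0⟩ := Submodule.exists_mem_ne_zero_of_ne_bot (hD0 (j, k j))
  have h1 := hG d
  rw [LinearMap.comp_apply, he1 {p | p.2 = k p.1} (j, k j) rfl d hd] at h1
  have h2 := hF j (k j) d hd
  have hle : ∀ F' : Finset (ℕ × ℕ), (j, k j) ∉ F' →
      (⨆ n ∈ F', D n) ≤ ⨆ n, ⨆ (_ : n ≠ (j, k j)), D n := fun F' hF' ↦
    iSup₂_le fun n hn ↦ le_iSup₂ (f := fun n (_ : n ≠ (j, k j)) ↦ D n) n
      (by rintro rfl; exact hF' hn)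
  have h3 := Submodule.sub_mem _ (hle _ hjG h1) (hle _ (hk j) h2)
  rw [sub_sub_cancel] at h3
  exact hd0 (Submodule.disjoint_def.1 (hD (j, k j)) d hd h3)

theorem isSemisimpleModule_of_forall_relInjective_quotient [Module.Finite A P]
    [Module.Projective A P] (hq : ∀ K : Submodule A P, RelInjective A (P ⧸ K) P)
    (hs : ∀ N : Submodule A P, N.FG → N.HasProjection) : IsSemisimpleModule A P := by
  by_contra h
  obtain ⟨D, hD, hD0, hDfg⟩ := Submodule.exists_iSupIndep_of_not_isSemisimpleModule hs h
  exact not_iSupIndep_of_forall_relInjective_quotient hq hs (fun p ↦ D (Nat.pairEquiv p))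
    (hD.comp Nat.pairEquiv.injective) (fun n ↦ hD0 _) fun n ↦ hDfg _

end Osofsky

/-! ### Matrix units give semisimple summands -/

section MatrixUnits

variable {A : Type u} [Ring A]

/-- Every quotient of `N` is automorphism-invariant. -/
def QuotientsAutInvariant (A N : Type u) [Ring A] [AddCommGroup N] [Module A N] : Prop :=
  ∀ (M : Type u) [AddCommGroup M] [Module A M] (f : N →ₗ[A] M), Function.Surjective f →
    IsAutomorphismInvariant A M

/-- The sum of a summand `V` with the image of `h` is a summand if the part of that image
complementary to `V` is one. -/
theorem Submodule.HasProjection.sup_range {N P : Type*} [AddCommGroup N] [Module A N]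
    [AddCommGroup P] [Module A P] {V : Submodule A P} {ρ : P →ₗ[A] P} (h1 : ∀ x, ρ x ∈ V)
    (h2 : ∀ x ∈ V, ρ x = x) (h : N →ₗ[A] P)
    (hX : (LinearMap.range (h - ρ ∘ₗ h)).HasProjection) :
    (V ⊔ LinearMap.range h).HasProjection := by
  obtain ⟨σ, h3, h4⟩ := hX
  refine ⟨ρ + σ ∘ₗ (LinearMap.id - ρ), fun x ↦ ?_, fun x hx ↦ ?_⟩
  · obtain ⟨n, hn⟩ := h3 (x - ρ x)
    have : ((ρ + σ ∘ₗ (LinearMap.id - ρ) : P →ₗ[A] P)) x = (ρ x - ρ (h n)) + h n := by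
      simp only [LinearMap.add_apply, LinearMap.comp_apply, LinearMap.sub_apply, LinearMap.id_apply,
        ← hn]
      abel
    rw [this]
    exact Submodule.add_mem_sup (V.sub_mem (h1 _) (h1 _)) ⟨n, rfl⟩
  · obtain ⟨v, hv, _, ⟨n, rfl⟩, rfl⟩ := Submodule.mem_sup.1 hx
    have h5 : σ (h n - ρ (h n)) = h n - ρ (h n) := h4 _ ⟨n, rfl⟩
    simp [h2 v hv, h5]

variable {N : Type u} [AddCommGroup N] [Module A N]

theorem QuotientsAutInvariant.relInjective_of_comp_eq_zero (hN : QuotientsAutInvariant A N)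
    {e : N →ₗ[A] N} (he : ∀ x, e (e x) = e x) {X : Type u} [AddCommGroup X] [Module A X]
    (h : N →ₗ[A] X) (hh : Function.Surjective h) (h0 : ∀ x, h (e x) = 0) :
    RelInjective A X (LinearMap.range e) := by
  refine relInjective_of_isAutomorphismInvariant_prod (hN _ (h.prod e.rangeRestrict) ?_)
  rintro ⟨x, _, y, rfl⟩
  obtain ⟨n, rfl⟩ := hh x
  refine ⟨n - e n + e y, Prod.ext ?_ (Subtype.ext ?_)⟩
  · simp [h0]
  · simp [he]

/-- If `a`, `b` are off-diagonal matrix units, then both the images of the summand `range (b ∘ a)`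
and those of its complement are injective relative to `range (b ∘ a)`, so Osofsky's argument shows
that this summand is semisimple. -/
theorem QuotientsAutInvariant.isSemisimpleModule_range [Module.Finite A N] [Module.Projective A N]
    (hN : QuotientsAutInvariant A N)
    (hgen : ∀ x : N, ∃ φ : N →ₗ[A] N, LinearMap.range φ = Submodule.span A {x})
    {a b : N →ₗ[A] N} (haa : ∀ x, a (a x) = 0) (haba : ∀ x, a (b (a x)) = a x) :
    IsSemisimpleModule A (LinearMap.range (b ∘ₗ a)) := by
  set e := b ∘ₗ a with he
  have hea : ∀ x, e x = b (a x) := fun x ↦ rfl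
  have hee : ∀ x, e (e x) = e x := fun x ↦ by simp [hea, haba]
  have hproj : (LinearMap.range e).HasProjection :=
    ⟨e, fun x ↦ ⟨x, rfl⟩, by rintro _ ⟨y, rfl⟩; exact hee y⟩
  have := hproj.projective
  have hab : ∀ x, (a ∘ₗ b) ((a ∘ₗ b) x) = (a ∘ₗ b) x := fun x ↦ by simp [haba]
  have good : ∀ (X : Type u) [AddCommGroup X] [Module A X] (h : N →ₗ[A] X),
      Function.Surjective h → (∀ x, h (e x) = h x) → RelInjective A X (LinearMap.range e) := by
    intro X _ _ h hh hhe
    refine (hN.relInjective_of_comp_eq_zero hab h hh fun x ↦ ?_).of_injective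
      ((a ∘ₗ b ∘ₗ a).restrict (p := LinearMap.range e) (q := LinearMap.range (a ∘ₗ b))
        fun x _ ↦ ⟨a x, rfl⟩) ?_
    · rw [← hhe]
      simp [hea, haa]
    · rw [← LinearMap.ker_eq_bot, eq_bot_iff]
      rintro ⟨_, x, rfl⟩ hx
      have hx' : a (b (a (e x))) = 0 := congrArg Subtype.val (LinearMap.mem_ker.1 hx)
      rw [haba, hea, haba] at hx'
      exact Subtype.ext (by simp [hea, hx'])
  refine isSemisimpleModule_of_forall_relInjective_quotient (fun K ↦ ?_) fun K hK ↦ ?_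
  · refine good _ (K.mkQ ∘ₗ e.rangeRestrict)
      (K.mkQ_surjective.comp e.surjective_rangeRestrict) fun x ↦ ?_
    have : e.rangeRestrict (e x) = e.rangeRestrict x := Subtype.ext (hee x)
    simp [this]
  -- A summand stays a summand after adding an image of `range e` or of its complement, hence
  -- after adding any finitely generated submodule.
  · have hsum : ∀ (h : N →ₗ[A] LinearMap.range e),
        (∀ x, h (e x) = h x) ∨ (∀ x, h (e x) = 0) → ∀ V : Submodule A (LinearMap.range e),
        V.HasProjection → (V ⊔ LinearMap.range h).HasProjection := by
      rintro h hh V ⟨ρ, h1, h2⟩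
      refine Submodule.HasProjection.sup_range h1 h2 h ?_
      set k := h - ρ ∘ₗ h
      have hrel : RelInjective A (LinearMap.range k) (LinearMap.range e) := by
        rcases hh with hh | hh
        · exact good _ k.rangeRestrict k.surjective_rangeRestrict fun x ↦
            Subtype.ext (by simp [k, hh])
        · exact hN.relInjective_of_comp_eq_zero hee k.rangeRestrict k.surjective_rangeRestrict
            fun x ↦ Subtype.ext (by simp [k, hh])
      obtain ⟨g, hg⟩ := hrel (LinearMap.range k) LinearMap.id
      exact ⟨(LinearMap.range k).subtype ∘ₗ g, fun x ↦ (g x).2,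
        fun x hx ↦ congrArg Subtype.val (hg ⟨x, hx⟩)⟩
    have hfg : ∀ V : Submodule A (LinearMap.range e), V.HasProjection → (V ⊔ K).HasProjection := by
      induction K, hK using Submodule.fg_induction with
      | singleton x =>
        intro V hV
        obtain ⟨ψ, hψ⟩ : ∃ ψ : N →ₗ[A] LinearMap.range e,
            LinearMap.range ψ = Submodule.span A {x} := by
          obtain ⟨φ, hφ⟩ := hgen x
          refine ⟨e.rangeRestrict ∘ₗ φ, ?_⟩
          have hx : e.rangeRestrict x = x := by
            obtain ⟨_, y, rfl⟩ := x
            exact Subtype.ext (hee y)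
          rw [LinearMap.range_comp φ e.rangeRestrict, hφ, Submodule.map_span,
            Set.image_singleton, hx]
        have hsplit : LinearMap.range ψ =
            LinearMap.range (ψ ∘ₗ e) ⊔
              LinearMap.range (ψ ∘ₗ (LinearMap.id - e)) := by
          refine le_antisymm ?_ (sup_le ?_ ?_)
          · rintro _ ⟨y, rfl⟩
            exact Submodule.mem_sup.2 ⟨_, ⟨y, rfl⟩, _, ⟨y, rfl⟩, by simp⟩
          · rintro _ ⟨y, rfl⟩
            exact ⟨_, rfl⟩
          · rintro _ ⟨y, rfl⟩
            exact ⟨_, rfl⟩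
        rw [← hψ, hsplit, ← sup_assoc]
        exact hsum _ (Or.inr fun x ↦ by simp [hee]) _ (hsum _ (Or.inl fun x ↦ by simp [hee]) V hV)
      | sup K₁ K₂ _ _ ih₁ ih₂ =>
        intro V hV
        rw [← sup_assoc]
        exact ih₂ _ (ih₁ V hV)
    simpa using hfg ⊥ ⟨0, by simp, fun x hx ↦ by simpa using ((Submodule.mem_bot A).1 hx).symm⟩

/-- A submodule with an independent isomorphic copy is a direct summand. -/
theorem QuotientsAutInvariant.hasProjection_range [Module.Finite A N] [Module.Projective A N]
    (hN : QuotientsAutInvariant A N)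
    (hgen : ∀ x : N, ∃ φ : N →ₗ[A] N, LinearMap.range φ = Submodule.span A {x})
    {X : Type u} [AddCommGroup X] [Module A X] (p q : X →ₗ[A] N) (hp : Function.Injective p)
    (hq : Function.Injective q) (hpq : Disjoint (LinearMap.range p) (LinearMap.range q)) :
    (LinearMap.range p).HasProjection := by
  obtain ⟨a, b, haa, hbb, haba, hbab, hab⟩ :=
    (hN N LinearMap.id Function.surjective_id).exists_matrixUnits p q hp hq hpq
  have := hN.isSemisimpleModule_range hgen haa haba
  set e := b ∘ₗ a with he
  have hpe : ∀ x, e (p x) = p x := fun x ↦ by simp [he, hab]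
  obtain ⟨g, hg⟩ := IsSemisimpleModule.extension_property
    (p.codRestrict (LinearMap.range e) fun x ↦ ⟨p x, hpe x⟩)
    (fun x y h ↦ hp (congrArg Subtype.val h)) LinearMap.id
  refine ⟨p ∘ₗ g ∘ₗ e.rangeRestrict, fun x ↦ ⟨_, rfl⟩, ?_⟩
  rintro _ ⟨x, rfl⟩
  have h1 : e.rangeRestrict (p x) = ⟨p x, p x, hpe x⟩ := Subtype.ext (hpe x)
  have h2 : g ⟨p x, p x, hpe x⟩ = x := LinearMap.congr_fun hg x
  simp only [LinearMap.comp_apply, h1, h2]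

/-- The maximal pair of independent isomorphic submodules: `N` is the direct sum of the images of
the idempotents `b ∘ a`, `a ∘ b`, which are matched by the matrix units `a`, `b`, and of a
complement that contains no two independent copies of a nonzero module. -/
theorem IsAutomorphismInvariant.exists_maximal_matrixUnits (hN : IsAutomorphismInvariant A N) :
    ∃ a b : N →ₗ[A] N, (∀ x, a (a x) = 0) ∧ (∀ x, b (b x) = 0) ∧ (∀ x, a (b (a x)) = a x) ∧
      (∀ x, b (a (b x)) = b x) ∧
      ∀ (X : Type u) [AddCommGroup X] [Module A X] (p q : X →ₗ[A] N), Function.Injective p →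
        Function.Injective q → Disjoint (LinearMap.range p) (LinearMap.range q) →
        (∀ x, a (p x) = 0) → (∀ x, b (p x) = 0) → (∀ x, a (q x) = 0) → (∀ x, b (q x) = 0) →
        ∀ x : X, x = 0 := by
  -- A pair of isomorphic submodules is encoded by the graph of the isomorphism.
  obtain ⟨G, -, hG, hGmax⟩ := Submodule.exists_maximal_of_forall (A := A)
    (fun g h : N × N ↦ (g.1 = h.2 → g.1 = 0) ∧ (g.1 = 0 ↔ g.2 = 0)) ⊥ (by simp)
  obtain ⟨a, b, haa, hbb, haba, hbab, hab⟩ := hN.exists_matrixUnits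
    (LinearMap.fst A N N ∘ₗ G.subtype) (LinearMap.snd A N N ∘ₗ G.subtype) (by
      rw [← LinearMap.ker_eq_bot, eq_bot_iff]
      rintro ⟨g, hg⟩ h0
      exact Subtype.ext (Prod.ext h0 (((hG g hg g hg).2).1 h0))) (by
      rw [← LinearMap.ker_eq_bot, eq_bot_iff]
      rintro ⟨g, hg⟩ h0
      exact Subtype.ext (Prod.ext (((hG g hg g hg).2).2 h0) h0)) (by
      rw [Submodule.disjoint_def]
      rintro _ ⟨g, rfl⟩ ⟨h, hh⟩
      exact (hG g g.2 h h.2).1 hh.symm)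
  refine ⟨a, b, haa, hbb, haba, hbab, ?_⟩
  intro X _ _ p q hp hq hpq hap hbp haq hbq x
  let m : N × X →ₗ[A] N × N :=
    ((b ∘ₗ a).coprod p).prod (a.coprod q)
  have hm : ∀ n x, m (n, x) = (b (a n) + p x, a n + q x) := fun n x ↦ rfl
  have hle : G ≤ LinearMap.range m := by
    rintro ⟨u, w⟩ hg
    obtain ⟨h1, h2⟩ := hab ⟨(u, w), hg⟩
    have h1' : a u = w := h1
    have h2' : b w = u := h2
    exact ⟨(u, 0), by rw [hm, h1', h2']; simp⟩
  have key : LinearMap.range m = G := by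
    refine hGmax _ hle ?_
    rintro _ ⟨⟨n, x⟩, rfl⟩ _ ⟨⟨n', x'⟩, rfl⟩
    simp only [hm]
    have h0 : ∀ y, p y = 0 → y = 0 := fun y hy ↦ hp (hy.trans (map_zero p).symm)
    have h0' : ∀ y, q y = 0 → y = 0 := fun y hy ↦ hq (hy.trans (map_zero q).symm)
    refine ⟨fun h ↦ ?_, fun h ↦ ?_, fun h ↦ ?_⟩
    · have h1 := congrArg a h
      have h2 := congrArg b h
      simp only [map_add, haba, hap, haa, haq, hbb, hbp, hbq, add_zero] at h1 h2
      have h3 : a n' = 0 := by rw [← haba, ← h2, map_zero]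
      rw [h1, h3, map_zero, zero_add, zero_add] at h
      have h4 := Submodule.disjoint_def.1 hpq _ ⟨x, rfl⟩ ⟨x', h.symm⟩
      simp [h1, h4]
    · have h1 := congrArg a h
      simp only [map_add, haba, hap, add_zero, map_zero] at h1
      rw [h1, map_zero, zero_add] at h
      simp [h1, h0 _ h]
    · have h1 := congrArg b h
      simp only [map_add, hbq, add_zero, map_zero] at h1
      have h3 : a n = 0 := by rw [← haba, h1, map_zero]
      rw [h3, zero_add] at h
      simp [h3, h0' _ h]
  have hx : (p x, q x) ∈ G := key ▸ ⟨(0, x), by simp [hm]⟩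
  have h1 : a (p x) = q x := (hab ⟨_, hx⟩).1
  exact hq (by rw [← h1, hap, map_zero])

end MatrixUnits

/-! ### The central idempotent -/

section Decomposition

variable {A : Type u} [Ring A] {N : Type u} [AddCommGroup N] [Module A N]

/-- A central idempotent endomorphism `g` splits `N` into a semisimple and a square-free part. The
semisimple part is generated by the maximal pair of independent isomorphic submodules together
with the largest image `range h` of one of them in the complement of the pair. -/
theorem QuotientsAutInvariant.exists_central_idempotent [Module.Finite A N] [Module.Projective A N]
    (hN : QuotientsAutInvariant A N)
    (hgen : ∀ x : N, ∃ φ : N →ₗ[A] N, LinearMap.range φ = Submodule.span A {x}) :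
    ∃ g : N →ₗ[A] N, (∀ x, g (g x) = g x) ∧ (∀ (y : N →ₗ[A] N) (x : N), g (y x) = y (g x)) ∧
      IsSemisimpleModule A (LinearMap.ker g) ∧ IsSquareFreeModule A (LinearMap.range g) := by
  obtain ⟨a, b, haa, hbb, haba, hbab, hsq⟩ :=
    (hN N LinearMap.id Function.surjective_id).exists_maximal_matrixUnits
  have hssP : IsSemisimpleModule A (LinearMap.range (b ∘ₗ a)) :=
    hN.isSemisimpleModule_range hgen haa haba
  have hssQ : IsSemisimpleModule A (LinearMap.range (a ∘ₗ b)) :=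
    hN.isSemisimpleModule_range hgen hbb hbab
  set P := LinearMap.range (b ∘ₗ a)
  have hbaP : ∀ x, b (a x) ∈ P := fun x ↦ ⟨x, rfl⟩
  have hPba : ∀ x ∈ P, b (a x) = x := by
    rintro _ ⟨x, rfl⟩
    simp [haba]
  -- Among the maps from `P` to the complement of the pair, choose `h` with minimal kernel.
  obtain ⟨_, ⟨h, hah, hbh, rfl⟩, hmin⟩ := IsArtinian.set_has_minimal
    {K : Submodule A P | ∃ h : P →ₗ[A] N, (∀ x, a (h x) = 0) ∧ (∀ x, b (h x) = 0) ∧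
      K = LinearMap.ker h} ⟨_, 0, by simp, by simp, rfl⟩
  obtain ⟨P₁, hP₁⟩ := exists_isCompl (LinearMap.ker h)
  have hP₁' : ∀ x ∈ P₁, h x = 0 → x = 0 := fun x hx h0 ↦
    Submodule.disjoint_def.1 hP₁.disjoint x h0 hx
  have hsplit : ∀ x : P, ∃ k, h k = 0 ∧ ∃ y ∈ P₁, x = k + y := by
    intro x
    have hx : x ∈ LinearMap.ker h ⊔ P₁ := hP₁.sup_eq_top ▸ Submodule.mem_top
    obtain ⟨k, hk, y, hy, hxy⟩ := Submodule.mem_sup.1 hx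
    exact ⟨k, hk, y, hy, hxy.symm⟩
  have hrange : LinearMap.range (h ∘ₗ P₁.subtype) = LinearMap.range h := by
    refine le_antisymm ?_ ?_
    · rintro _ ⟨x, rfl⟩
      exact ⟨_, rfl⟩
    · rintro _ ⟨x, rfl⟩
      obtain ⟨k, hk, y, hy, rfl⟩ := hsplit x
      exact ⟨⟨y, hy⟩, by simp [hk]⟩
  have hproj : (LinearMap.range h).HasProjection := by
    rw [← hrange]
    refine hN.hasProjection_range hgen _ (P.subtype ∘ₗ P₁.subtype) ?_
      (P.injective_subtype.comp P₁.injective_subtype) ?_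
    · rw [← LinearMap.ker_eq_bot, eq_bot_iff]
      intro x hx
      exact Subtype.ext (hP₁' x x.2 hx)
    · rw [Submodule.disjoint_def]
      rintro _ ⟨x, rfl⟩ ⟨y, hy⟩
      have hy' : (y : N) = h x := hy
      change h x = 0
      rw [← hy', ← hPba _ (y : P).2, hy', hah, map_zero]
  have hprojD := hproj.projective
  obtain ⟨ρ, hρ1, hρ2⟩ := hproj
  let c : N →ₗ[A] N := LinearMap.id - b ∘ₗ a - a ∘ₗ b
  have hc : ∀ x, c x = x - b (a x) - a (b x) := fun x ↦ rfl
  have hac : ∀ x, a (c x) = 0 := fun x ↦ by simp [hc, haba, haa]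
  have hbc : ∀ x, b (c x) = 0 := fun x ↦ by simp [hc, hbab, hbb]
  have hc1 : ∀ x, a x = 0 → b x = 0 → c x = x := fun x h1 h2 ↦ by simp [hc, h1, h2]
  have haρ : ∀ x, a (ρ x) = 0 := fun x ↦ by
    obtain ⟨y, hy⟩ := hρ1 x
    rw [← hy, hah]
  have hbρ : ∀ x, b (ρ x) = 0 := fun x ↦ by
    obtain ⟨y, hy⟩ := hρ1 x
    rw [← hy, hbh]
  have hρh : ∀ x, ρ (h x) = h x := fun x ↦ hρ2 _ ⟨x, rfl⟩
  -- Every map from `P` to the complement of the pair has its image in `range h`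
  have hD : ∀ h' : P →ₗ[A] N, (∀ x, a (h' x) = 0) → (∀ x, b (h' x) = 0) →
      ∀ x, ρ (h' x) = h' x := by
    intro h' hah' hbh'
    let k := h' - ρ ∘ₗ h'
    have hk : ∀ x, k x = h' x - ρ (h' x) := fun x ↦ rfl
    have hak : ∀ x, a (k x) = 0 := fun x ↦ by simp [hk, hah', haρ]
    have hbk : ∀ x, b (k x) = 0 := fun x ↦ by simp [hk, hbh', hbρ]
    have hρk : ∀ x, ρ (k x) = 0 := fun x ↦ by simp [hk, hρ2 _ (hρ1 _)]
    -- Otherwise the complement of the pair would contain a square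
    have hk1 : ∀ x ∈ P₁, k x = 0 := by
      obtain ⟨P₂, hP₂⟩ := exists_isCompl (LinearMap.ker (k ∘ₗ P₁.subtype))
      have hP₂0 := hsq P₂ (h ∘ₗ P₁.subtype ∘ₗ P₂.subtype) (k ∘ₗ P₁.subtype ∘ₗ P₂.subtype)
        ((injective_iff_map_eq_zero _).2 fun x hx ↦
          Subtype.ext (Subtype.ext (hP₁' _ x.1.2 hx))) ((injective_iff_map_eq_zero _).2 fun x hx ↦
          Subtype.ext (Submodule.disjoint_def.1 hP₂.disjoint x hx x.2)) (by
          rw [Submodule.disjoint_def]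
          rintro _ ⟨x, rfl⟩ ⟨y, hy⟩
          have h1 : ρ (k y) = ρ (h x) := congrArg ρ hy
          rw [hρk, hρh] at h1
          exact h1.symm) (fun x ↦ hah _) (fun x ↦ hbh _) (fun x ↦ hak _) (fun x ↦ hbk _)
      intro x hx
      have hx' : (⟨x, hx⟩ : P₁) ∈ LinearMap.ker (k ∘ₗ P₁.subtype) ⊔ P₂ :=
        hP₂.sup_eq_top ▸ Submodule.mem_top
      obtain ⟨y, hy, z, hz, hyz⟩ := Submodule.mem_sup.1 hx'
      have hz0 : z = 0 := congrArg Subtype.val (hP₂0 ⟨z, hz⟩)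
      rw [hz0, add_zero] at hyz
      subst hyz
      exact hy
    have hle : LinearMap.ker (h + k) ≤ LinearMap.ker h := by
      intro x hx
      have h1 : h x + k x = 0 := hx
      have h2 := congrArg ρ h1
      rwa [map_add, hρk, hρh, add_zero, map_zero] at h2
    have heq : LinearMap.ker (h + k) = LinearMap.ker h := by
      by_contra hne
      exact hmin _ ⟨h + k, fun x ↦ by simp [hah, hak], fun x ↦ by simp [hbh, hbk], rfl⟩
        (lt_of_le_of_ne hle hne)
    intro x
    obtain ⟨y, hy, z, hz, rfl⟩ := hsplit x
    have h1 : k y = 0 := by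
      have h2 : y ∈ LinearMap.ker (h + k) := heq ▸ hy
      have h3 : h y + k y = 0 := h2
      rwa [hy, zero_add] at h3
    have h2 : k (y + z) = 0 := by rw [map_add, h1, hk1 z hz, add_zero]
    exact (sub_eq_zero.1 h2).symm
  let g : N →ₗ[A] N := c - ρ ∘ₗ c
  have hg : ∀ x, g x = c x - ρ (c x) := fun x ↦ rfl
  have hag : ∀ x, a (g x) = 0 := fun x ↦ by simp [hg, hac, haρ]
  have hbg : ∀ x, b (g x) = 0 := fun x ↦ by simp [hg, hbc, hbρ]
  have hρg : ∀ x, ρ (g x) = 0 := fun x ↦ by simp [hg, hρ2 _ (hρ1 _)]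
  have hgg : ∀ x, g (g x) = g x := fun x ↦ by
    rw [hg (g x), hc1 _ (hag x) (hbg x), hρg, sub_zero]
  have h1g : ∀ x, x = b (a x) + a (b x) + ρ (c x) + g x := fun x ↦ by
    rw [hg, hc]; abel
  -- No map from the semisimple part to the rest
  have hgP : ∀ (y : N →ₗ[A] N) (x : P), g (y x) = 0 := by
    intro y x
    have h1 := hD (c ∘ₗ y ∘ₗ P.subtype) (fun x ↦ hac _) (fun x ↦ hbc _) x
    exact sub_eq_zero.2 h1.symm
  have hga : ∀ (y : N →ₗ[A] N) x, g (y (a x)) = 0 := fun y x ↦ by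
    have := hgP (y ∘ₗ a) ⟨_, hbaP x⟩
    rwa [LinearMap.comp_apply, haba] at this
  have hgb : ∀ (y : N →ₗ[A] N) x, g (y (b x)) = 0 := fun y x ↦ by
    exact hgP y ⟨b x, by simpa [hbab] using hbaP (b x)⟩
  have hgρ : ∀ (y : N →ₗ[A] N) x, g (y (ρ x)) = 0 := fun y x ↦ by
    obtain ⟨z, hz⟩ := hρ1 x
    have := hgP (y ∘ₗ h ∘ₗ (b ∘ₗ a).rangeRestrict) z
    have hz' : (b ∘ₗ a).rangeRestrict z = z := Subtype.ext (hPba _ z.2)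
    rwa [LinearMap.comp_apply, LinearMap.comp_apply, hz', hz] at this
  -- No map from the rest to the semisimple part: its image would be projective, so it would embed
  -- into the rest.
  have hPg : ∀ (y : N →ₗ[A] N) x, b (a (y (g x))) = 0 := by
    intro y
    let f : N →ₗ[A] P := (b ∘ₗ a).rangeRestrict ∘ₗ y ∘ₗ g
    have hfg : ∀ x, f (g x) = f x := fun x ↦
      congrArg (fun z ↦ (b ∘ₗ a).rangeRestrict (y z)) (hgg x)
    obtain ⟨W, hW⟩ := exists_isCompl (LinearMap.range f)
    have hτ := Submodule.projectionOnto_apply_left hW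
    have hPp : Module.Projective A P :=
      Submodule.HasProjection.projective ⟨b ∘ₗ a, hbaP, hPba⟩
    have : Module.Projective A (LinearMap.range f) :=
      Module.Projective.of_split (LinearMap.range f).subtype
        ((LinearMap.range f).projectionOnto W hW) (LinearMap.ext hτ)
    obtain ⟨s, h_s⟩ := Module.projective_lifting_property f.rangeRestrict LinearMap.id
      f.surjective_rangeRestrict
    intro x
    have hfx : f.rangeRestrict (s (f.rangeRestrict x)) = f.rangeRestrict x :=
      LinearMap.congr_fun h_s _
    have hs0 : g (s (f.rangeRestrict x)) = 0 := by
      have := hgP (s ∘ₗ (LinearMap.range f).projectionOnto W hW ∘ₗ (b ∘ₗ a).rangeRestrict)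
        (f x)
      have h2 : (b ∘ₗ a).rangeRestrict (f x : N) = f x := Subtype.ext (hPba _ (f x).2)
      rw [LinearMap.comp_apply, LinearMap.comp_apply, h2] at this
      have h5 : (LinearMap.range f).projectionOnto W hW (f x) = f.rangeRestrict x :=
        hτ (f.rangeRestrict x)
      rwa [h5] at this
    have h3 : f x = 0 := by
      rw [show f x = f (s (f.rangeRestrict x)) from (congrArg Subtype.val hfx).symm, ← hfg, hs0,
        map_zero]
    exact congrArg Subtype.val h3
  have hag' : ∀ (y : N →ₗ[A] N) x, a (y (g x)) = 0 := fun y x ↦ by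
    rw [← haba, hPg, map_zero]
  have hbg' : ∀ (y : N →ₗ[A] N) x, b (y (g x)) = 0 := fun y x ↦ by
    have := hPg (b ∘ₗ y) x
    rwa [LinearMap.comp_apply, hbab] at this
  have hρg' : ∀ (y : N →ₗ[A] N) x, ρ (y (g x)) = 0 := by
    obtain ⟨θ, hθ⟩ := Module.projective_lifting_property h.rangeRestrict LinearMap.id
      h.surjective_rangeRestrict
    intro y x
    have h1 : h (θ (ρ.codRestrict _ hρ1 (y (g x)))) = ρ (y (g x)) :=
      congrArg Subtype.val (LinearMap.congr_fun hθ (ρ.codRestrict _ hρ1 (y (g x))))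
    have h2 := hPg (P.subtype ∘ₗ θ ∘ₗ ρ.codRestrict _ hρ1 ∘ₗ y) x
    have h3 : θ (ρ.codRestrict _ hρ1 (y (g x))) = 0 := Subtype.ext (by
      rw [← hPba _ (θ (ρ.codRestrict _ hρ1 (y (g x)))).2]
      exact h2)
    rw [← h1, h3, map_zero]
  refine ⟨g, hgg, fun y x ↦ ?_, ?_, ?_⟩
  · conv_lhs => rw [h1g x]
    rw [map_add, map_add, map_add, map_add, map_add, map_add, hgb, hga, hgρ, zero_add, zero_add,
      zero_add, hg, hc1 _ (hag' y x) (hbg' y x), hρg', sub_zero]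
  · have hssD : IsSemisimpleModule A (LinearMap.range h) := IsSemisimpleModule.range h
    have hle : LinearMap.ker g ≤ (P ⊔ LinearMap.range (a ∘ₗ b)) ⊔ LinearMap.range h := by
      intro x hx
      rw [h1g x, LinearMap.mem_ker.1 hx, add_zero]
      exact Submodule.add_mem_sup (Submodule.add_mem_sup (hbaP x) ⟨x, rfl⟩) (hρ1 _)
    have := (IsSemisimpleModule.sup hssP hssQ).sup hssD
    exact IsSemisimpleModule.of_injective _ (Submodule.inclusion_injective hle)
  · rintro ⟨X, Y, hX, -, hXY, ⟨e⟩⟩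
    refine hX ((Submodule.eq_bot_iff X).2 fun x hx ↦ ?_)
    have h0 := hsq X ((LinearMap.range g).subtype ∘ₗ X.subtype)
      ((LinearMap.range g).subtype ∘ₗ Y.subtype ∘ₗ e.toLinearMap)
      (Subtype.val_injective.comp Subtype.val_injective)
      ((Subtype.val_injective.comp Subtype.val_injective).comp e.injective) (by
        rw [Submodule.disjoint_def]
        rintro _ ⟨x, rfl⟩ ⟨y, hy⟩
        have h1 : (x : LinearMap.range g) ∈ X ⊓ Y := ⟨x.2, by
          rw [← Subtype.ext (a1 := (e y : LinearMap.range g)) (a2 := x) hy]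
          exact (e y).2⟩
        rw [hXY, Submodule.mem_bot] at h1
        exact congrArg Subtype.val h1)
      (fun x ↦ ?_) (fun x ↦ ?_) (fun x ↦ ?_) (fun x ↦ ?_) ⟨x, hx⟩
    · exact congrArg Subtype.val h0
    · obtain ⟨y, hy⟩ := (x : LinearMap.range g).2
      exact (congrArg a hy).symm.trans (hag y)
    · obtain ⟨y, hy⟩ := (x : LinearMap.range g).2
      exact (congrArg b hy).symm.trans (hbg y)
    · obtain ⟨y, hy⟩ := (e x : LinearMap.range g).2
      exact (congrArg a hy).symm.trans (hag y)
    · obtain ⟨y, hy⟩ := (e x : LinearMap.range g).2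
      exact (congrArg b hy).symm.trans (hbg y)

end Decomposition

/-! ### Square-free modules have no square quotients -/

section SquareFree

variable {A : Type u} [Ring A] {M : Type v} [AddCommGroup M] [Module A M]

theorem IsSquareFreeModule.eq_zero_of_injective {A M X : Type*} [Ring A] [AddCommGroup M]
    [Module A M] [AddCommGroup X] [Module A X] (hM : IsSquareFreeModule A M) (p q : X →ₗ[A] M)
    (hp : Function.Injective p) (hq : Function.Injective q)
    (hpq : Disjoint (LinearMap.range p) (LinearMap.range q)) (x : X) : x = 0 := by
  by_contra hx
  refine hM ⟨LinearMap.range p, LinearMap.range q, fun h ↦ hx ?_, fun h ↦ hx ?_, hpq.eq_bot,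
    ⟨(LinearEquiv.ofInjective p hp).symm.trans (LinearEquiv.ofInjective q hq)⟩⟩
  · exact hp (by rw [LinearMap.range_eq_bot.1 h, LinearMap.zero_apply, LinearMap.zero_apply])
  · exact hq (by rw [LinearMap.range_eq_bot.1 h, LinearMap.zero_apply, LinearMap.zero_apply])

theorem IsSquareFreeModule.of_isInjectiveHull {A N E : Type u} [Ring A] [AddCommGroup N]
    [Module A N] [AddCommGroup E] [Module A E] (hN : IsSquareFreeModule A N) {i : N →ₗ[A] E}
    (hi : IsInjectiveHull i) : IsSquareFreeModule A E := by
  rintro ⟨X, Y, hX, -, hXY, ⟨e⟩⟩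
  obtain ⟨hi, -, hess⟩ := hi
  rw [essentialIn_iff] at hess
  obtain ⟨x, hx, hx0⟩ := Submodule.exists_mem_ne_zero_of_ne_bot hX
  -- Restrict the isomorphism to the elements of `X` in `N` whose images are in `N`.
  let f : X →ₗ[A] E := X.subtype
  let g : X →ₗ[A] E := Y.subtype ∘ₗ e.toLinearMap
  have hg0 : ∀ x, g x = 0 → x = 0 := fun x h ↦ by
    have : e x = 0 := Subtype.ext h
    simpa using this
  let X' : Submodule A X := (LinearMap.range i).comap f ⊓ (LinearMap.range i).comap g
  obtain ⟨p, hp⟩ := LinearMap.exists_comp_eq_of_injective i hi (f ∘ₗ X'.subtype) fun y ↦ y.2.1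
  obtain ⟨q, hq⟩ := LinearMap.exists_comp_eq_of_injective i hi (g ∘ₗ X'.subtype) fun y ↦ y.2.2
  have key := hN.eq_zero_of_injective p q
    ((injective_iff_map_eq_zero _).2 fun y hy ↦ by
      have h1 := hp y
      rw [hy, map_zero] at h1
      exact Subtype.ext (Subtype.ext h1.symm))
    ((injective_iff_map_eq_zero _).2 fun y hy ↦ by
      have h1 := hq y
      rw [hy, map_zero] at h1
      exact Subtype.ext (hg0 _ h1.symm)) (by
      rw [Submodule.disjoint_def]
      rintro _ ⟨y, rfl⟩ ⟨z, hz⟩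
      have h1 := hp y
      rw [← hz, hq z] at h1
      have h2 : (y : E) ∈ X ⊓ Y := ⟨y.1.2, by
        have h3 : (y : E) = e z := h1.symm
        rw [h3]; exact (e z).2⟩
      rw [hXY, Submodule.mem_bot] at h2
      exact hi (by rw [hp]; simpa [f] using h2))
  obtain ⟨r, hr, hr0⟩ := hess.2 x trivial hx0
  have hgr : g (r • ⟨x, hx⟩) ≠ 0 := fun h ↦ hr0 (congrArg Subtype.val (hg0 _ h))
  obtain ⟨s, hs, hs0⟩ := hess.2 _ trivial hgr
  have hmem : s • r • (⟨x, hx⟩ : X) ∈ X' :=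
    ⟨Submodule.smul_mem _ s hr, by
      change g (s • r • ⟨x, hx⟩) ∈ LinearMap.range i
      rwa [map_smul]⟩
  have h0 : s • r • (⟨x, hx⟩ : X) = 0 := congrArg Subtype.val (key ⟨_, hmem⟩)
  exact hs0 (by rw [← map_smul, h0, map_zero])

/-- Injective endomorphisms of a square-free injective module are onto: the image is a summand,
and a complement would be independent of its own image. -/
theorem Module.Injective.surjective_of_injective_of_isSquareFreeModule {E : Type u}
    [AddCommGroup E] [Module A E] (hE : Module.Injective A E) (hsq : IsSquareFreeModule A E)
    (u : E →ₗ[A] E) (hu : Function.Injective u) : Function.Surjective u := by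
  obtain ⟨g, hg⟩ := hE.exists_extension u hu LinearMap.id
  have hgu : ∀ x, g (u x) = x := hg
  have h0 : ∀ x : LinearMap.ker g, x = 0 := hsq.eq_zero_of_injective (LinearMap.ker g).subtype
    (u ∘ₗ (LinearMap.ker g).subtype) Subtype.val_injective (hu.comp Subtype.val_injective) (by
      rw [Submodule.disjoint_def]
      rintro _ ⟨x, rfl⟩ ⟨y, hy⟩
      have h1 : g (u y) = g x := congrArg g hy
      rw [hgu, LinearMap.mem_ker.1 x.2] at h1
      have h2 : u y = x := hy
      rw [h1, map_zero] at h2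
      exact h2.symm)
  intro x
  refine ⟨g x, (sub_eq_zero.1 ?_).symm⟩
  exact congrArg Subtype.val (h0 ⟨x - u (g x), by simp [hgu]⟩)

theorem LinearMap.essential_ker_comp {z : M →ₗ[A] M} (hz : EssentialIn (LinearMap.ker z) ⊤)
    (y : M →ₗ[A] M) : EssentialIn (LinearMap.ker (z ∘ₗ y)) ⊤ := by
  rw [essentialIn_iff] at *
  refine ⟨le_top, fun x _ hx ↦ ?_⟩
  by_cases hy : y x = 0
  · exact ⟨1, by simp [hy], by simpa using hx⟩
  · obtain ⟨r, hr, hr0⟩ := hz.2 _ trivial hy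
    exact ⟨r, by simpa using hr, fun h ↦ hr0 (by rw [← map_smul, h, map_zero])⟩

theorem EssentialIn.inf_top {K L : Submodule A M} (hK : EssentialIn K ⊤) (hL : EssentialIn L ⊤) :
    EssentialIn (K ⊓ L) ⊤ :=
  ⟨le_top, fun N _ hNL ↦ hK.2 N le_top
    (hL.2 _ le_top (by rwa [inf_assoc]))⟩

/-- In a square-free module, a map from the range of `β` to the range of `α` has essential kernel if
the two ranges are independent. -/
theorem IsSquareFreeModule.essential_ker (hM : IsSquareFreeModule A M) (α β w : M →ₗ[A] M)
    (hαβ : ∀ x y, α x = β y → α x = 0) :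
    EssentialIn (LinearMap.ker (α ∘ₗ w ∘ₗ β)) ⊤ := by
  rw [essentialIn_iff]
  refine ⟨le_top, fun x _ hx ↦ ?_⟩
  by_cases hβx : β x = 0
  · exact ⟨1, by simp [hβx], by simpa using hx⟩
  by_contra! h
  have h1 : ∀ r : A, α (w (r • β x)) = 0 → r • β x = 0 := fun r hr ↦ by
    have h2 := h r (by simpa using hr)
    rw [← map_smul, h2, map_zero]
  have h0 := hM.eq_zero_of_injective (Submodule.span A {β x}).subtype
    (α ∘ₗ w ∘ₗ (Submodule.span A {β x}).subtype) Subtype.val_injective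
    ((injective_iff_map_eq_zero _).2 fun y hy ↦ by
      obtain ⟨y, hy'⟩ := y
      obtain ⟨r, rfl⟩ := Submodule.mem_span_singleton.1 hy'
      exact Subtype.ext (h1 r hy)) (by
      rw [Submodule.disjoint_def]
      rintro _ ⟨⟨y, hy'⟩, rfl⟩ ⟨z, hz⟩
      obtain ⟨r, rfl⟩ := Submodule.mem_span_singleton.1 hy'
      have h2 : α (w z) = β (r • x) := hz.trans (by simp)
      exact hz.symm.trans (hαβ _ _ h2)) ⟨β x, Submodule.mem_span_singleton_self _⟩
  exact hβx (congrArg Subtype.val h0)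

end SquareFree

section NoSquareQuotient

variable {A : Type u} [Ring A] {N : Type u} [AddCommGroup N] [Module A N]

/-- An automorphism of the injective hull restricts to an automorphism of the module. -/
theorem IsAutomorphismInvariant.exists_restrict (hN : IsAutomorphismInvariant A N) {E : Type u}
    [AddCommGroup E] [Module A E] {i : N →ₗ[A] E} (hi : IsInjectiveHull i) (g : E ≃ₗ[A] E) :
    ∃ u : N →ₗ[A] N, ∀ x, i (u x) = g (i x) :=
  LinearMap.exists_comp_eq_of_injective i hi.1 (g.toLinearMap ∘ₗ i) (hN E i hi g)

theorem IsAutomorphismInvariant.surjective_id_sub (hN : IsAutomorphismInvariant A N)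
    (hsq : IsSquareFreeModule A N) {z : N →ₗ[A] N} (hz : EssentialIn (LinearMap.ker z) ⊤) :
    Function.Surjective (LinearMap.id - z : N →ₗ[A] N) := by
  obtain ⟨E, _, _, i, hull⟩ := exists_isInjectiveHull A N
  obtain ⟨hi, hE, hess⟩ := id hull
  rw [essentialIn_iff] at hess hz
  obtain ⟨g, hg⟩ := hE.exists_extension i hi (i ∘ₗ (LinearMap.id - z))
  have hginj : Function.Injective g := by
    refine (injective_iff_map_eq_zero _).2 fun x hx ↦ ?_
    by_contra hx0
    obtain ⟨r, ⟨n, hn⟩, hr0⟩ := hess.2 x trivial hx0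
    have h1 : n - z n = 0 := hi (by
      have := hg n
      rw [hn, map_smul, hx, smul_zero] at this
      simpa using this.symm)
    have hn0 : n ≠ 0 := fun h ↦ hr0 (by rw [← hn, h, map_zero])
    obtain ⟨s, hs, hs0⟩ := hz.2 n trivial hn0
    refine hs0 ?_
    rw [sub_eq_zero.1 h1, ← map_smul]
    exact hs
  have hgsurj := hE.surjective_of_injective_of_isSquareFreeModule (hsq.of_isInjectiveHull hull) g
    hginj
  intro n
  let G := LinearEquiv.ofBijective g ⟨hginj, hgsurj⟩
  obtain ⟨u, hu⟩ := hN.exists_restrict hull G.symm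
  refine ⟨u n, hi ?_⟩
  have h1 := hg (u n)
  rw [hu] at h1
  exact h1.symm.trans (G.apply_symm_apply (i n))

/-- In a square-free automorphism-invariant module, modulo the endomorphisms with essential kernel
every `s ∘ t` is a right multiple of `t`. On the injective hull `t` agrees, up to an essential
kernel, with `u ∘ (1 - π)` for an automorphism `u` and an idempotent `π` that commutes with all
endomorphisms up to essential kernels, so `c = u⁻¹ ∘ s ∘ u` works. -/
theorem IsAutomorphismInvariant.exists_essential_ker_sub (hN : IsAutomorphismInvariant A N)
    (hsq : IsSquareFreeModule A N) (s t : N →ₗ[A] N) :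
    ∃ c : N →ₗ[A] N, EssentialIn (LinearMap.ker (s ∘ₗ t - t ∘ₗ c)) ⊤ := by
  obtain ⟨E, _, _, i, hull⟩ := exists_isInjectiveHull A N
  obtain ⟨hi, hE, hess⟩ := id hull
  have hsqE := hsq.of_isInjectiveHull hull
  obtain ⟨S, hS⟩ := hE.exists_extension i hi (i ∘ₗ s)
  obtain ⟨T, hT⟩ := hE.exists_extension i hi (i ∘ₗ t)
  simp only [LinearMap.comp_apply] at hS hT
  obtain ⟨K, hK, π, hπ1, hπ2⟩ := hE.exists_essentialIn_hasProjection (LinearMap.ker T)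
  rw [essentialIn_iff] at hK
  have hππ : ∀ x, π (π x) = π x := fun x ↦ hπ2 _ (hπ1 x)
  have hinj : ∀ l, π l = 0 → T l = 0 → l = 0 := fun l h1 h2 ↦ by
    rw [← hπ2 l (hK.1 h2), h1]
  -- By square-freeness, `T` maps `ker π` injectively to a submodule independent of `K`.
  have hTK : ∀ l, π l = 0 → T l ∈ K → l = 0 := by
    let X : Submodule A E := LinearMap.ker π ⊓ K.comap T
    have h0 := hsqE.eq_zero_of_injective X.subtype (T ∘ₗ X.subtype) Subtype.val_injective
      ((injective_iff_map_eq_zero _).2 fun x hx ↦ Subtype.ext (hinj x x.2.1 hx)) (by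
        rw [Submodule.disjoint_def]
        rintro _ ⟨x, rfl⟩ ⟨y, hy⟩
        have h1 : (x : E) ∈ K := by
          have h2 : T y = x := hy
          rw [← h2]; exact y.2.2
        exact (hπ2 _ h1).symm.trans x.2.1)
    exact fun l h1 h2 ↦ congrArg Subtype.val (h0 ⟨l, h1, h2⟩)
  let u₀ : E →ₗ[A] E := π + T ∘ₗ (LinearMap.id - π)
  have hu₀ : ∀ x, u₀ x = π x + T (x - π x) := fun x ↦ rfl
  have hu₀inj : Function.Injective u₀ := by
    refine (injective_iff_map_eq_zero _).2 fun x hx ↦ ?_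
    rw [hu₀] at hx
    have h1 : x - π x = 0 := hTK _ (by simp [hππ]) (by
      rw [eq_neg_of_add_eq_zero_right hx]; exact neg_mem (hπ1 x))
    rw [h1, map_zero, add_zero] at hx
    rwa [hx, sub_zero] at h1
  let u : E ≃ₗ[A] E := LinearEquiv.ofBijective u₀
    ⟨hu₀inj, hE.surjective_of_injective_of_isSquareFreeModule hsqE u₀ hu₀inj⟩
  have hu : ∀ x, u x = π x + T (x - π x) := hu₀
  obtain ⟨v, hv⟩ := hN.exists_restrict hull u
  obtain ⟨v', hv'⟩ := hN.exists_restrict hull u.symm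
  refine ⟨v' ∘ₗ s ∘ₗ v, ?_⟩
  let κ : E →ₗ[A] E := LinearMap.id - π
  have hκ : ∀ x, κ x = x - π x := fun x ↦ rfl
  have hπκ : ∀ x, π (κ x) = 0 := fun x ↦ by simp [hκ, hππ]
  have hκπ : ∀ x, κ (π x) = 0 := fun x ↦ by simp [hκ, hππ]
  have hκκ : ∀ x, κ (κ x) = κ x := fun x ↦ by rw [hκ (κ x), hπκ, sub_zero]
  let w : E →ₗ[A] E := u.symm.toLinearMap ∘ₗ S ∘ₗ u.toLinearMap
  have hw : ∀ x, w x = u.symm (S (u x)) := fun x ↦ rfl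
  have e1 : EssentialIn (LinearMap.ker (π ∘ₗ w ∘ₗ κ)) ⊤ := hsqE.essential_ker π κ w
    fun x y h ↦ by rw [← hππ, h, hπκ]
  have e2 : EssentialIn (LinearMap.ker (κ ∘ₗ w ∘ₗ π)) ⊤ := hsqE.essential_ker κ π w
    fun x y h ↦ by rw [← hκκ, h, hκπ]
  have e3 : EssentialIn (LinearMap.ker (T ∘ₗ π)) ⊤ := by
    rw [essentialIn_iff]
    refine ⟨le_top, fun x _ hx ↦ ?_⟩
    by_cases hπx : π x = 0
    · exact ⟨1, by simp [hπx], by simpa using hx⟩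
    · obtain ⟨r, hr, hr0⟩ := hK.2 (π x) (hπ1 x) hπx
      exact ⟨r, by simpa using hr, fun h ↦ hr0 (by rw [← map_smul, h, map_zero])⟩
  have e4 := (essentialIn_iff.1
    ((e1.inf_top e2).inf_top (e3.inf_top (LinearMap.essential_ker_comp e3 w)))).2
  rw [essentialIn_iff]
  refine ⟨le_top, fun n _ hn ↦ ?_⟩
  obtain ⟨r, ⟨⟨h1, h2⟩, h3, h4⟩, hr0⟩ := e4 (i n) trivial fun h ↦ hn (hi (by rw [h, map_zero]))
  refine ⟨r, hi ?_, fun h ↦ hr0 (by rw [← map_smul, h, map_zero])⟩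
  set x := r • i n with hx
  have hxi : i (r • n) = x := map_smul i r n
  have hTu : ∀ y, T y = u (κ y) + T (π y) := fun y ↦ by
    rw [hu, hπκ, sub_zero, zero_add, hκ, ← map_add, sub_add_cancel]
  have h1' : π (w (κ x)) = 0 := h1
  have h2' : κ (w (π x)) = 0 := h2
  have h3' : T (π x) = 0 := h3
  have h4' : T (π (w x)) = 0 := h4
  have hcomm : w (κ x) = κ (w x) := by
    have h5 : κ (w (κ x)) = w (κ x) := by rw [hκ, h1', sub_zero]
    have h6 : κ (w x) = κ (w (κ x)) + κ (w (π x)) := by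
      rw [← map_add, ← map_add, hκ x, sub_add_cancel]
    rw [h6, h2', add_zero, h5]
  have hst : S (T x) = T (w x) := by
    rw [hTu x, h3', add_zero, hTu (w x), h4', add_zero, ← hcomm, hw, u.apply_symm_apply]
  rw [LinearMap.sub_apply, map_sub, LinearMap.comp_apply, LinearMap.comp_apply,
    LinearMap.comp_apply, LinearMap.comp_apply, ← hS, ← hT, ← hT, hv', ← hS, hv, hxi, hst, map_zero, hw, sub_self]

/-- A projective square-free automorphism-invariant module maps onto no nonzero square `V × V`. -/
theorem IsAutomorphismInvariant.eq_zero_of_surjective_prod [Module.Projective A N]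
    (hN : IsAutomorphismInvariant A N) (hsq : IsSquareFreeModule A N) {V : Type u}
    [AddCommGroup V] [Module A V] (f : N →ₗ[A] V × V) (hf : Function.Surjective f) (v : V) :
    v = 0 := by
  obtain ⟨p, hp⟩ : ∃ p : N →ₗ[A] V, ∀ x, p x = (f x).1 := ⟨LinearMap.fst A V V ∘ₗ f, fun _ ↦ rfl⟩
  obtain ⟨q, hq⟩ : ∃ q : N →ₗ[A] V, ∀ x, q x = (f x).2 := ⟨LinearMap.snd A V V ∘ₗ f, fun _ ↦ rfl⟩
  have hps : Function.Surjective p := fun v ↦ by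
    obtain ⟨x, hx⟩ := hf (v, 0)
    exact ⟨x, by rw [hp, hx]⟩
  have hqs : Function.Surjective q := fun v ↦ by
    obtain ⟨x, hx⟩ := hf (0, v)
    exact ⟨x, by rw [hq, hx]⟩
  obtain ⟨s, hs⟩ := Module.projective_lifting_property p q hps
  obtain ⟨y, hy⟩ := Module.projective_lifting_property q p hqs
  obtain ⟨t, ht⟩ := Module.projective_lifting_property f ((0 : N →ₗ[A] V).prod q) hf
  have hs' : ∀ x, p (s x) = q x := LinearMap.congr_fun hs
  have hy' : ∀ x, q (y x) = p x := LinearMap.congr_fun hy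
  have hpt : ∀ x, p (t x) = 0 := fun x ↦
    (hp _).trans (congrArg Prod.fst (LinearMap.congr_fun ht x))
  have hqt : ∀ x, q (t x) = q x := fun x ↦
    (hq _).trans (congrArg Prod.snd (LinearMap.congr_fun ht x))
  obtain ⟨c, hc⟩ := hN.exists_essential_ker_sub hsq s t
  have hpz : ∀ x, p ((s ∘ₗ t - t ∘ₗ c) x) = q x := fun x ↦ by
    rw [LinearMap.sub_apply, map_sub, LinearMap.comp_apply, LinearMap.comp_apply, hs', hpt, hqt,
      sub_zero]
  obtain ⟨n, rfl⟩ := hps v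
  obtain ⟨m, rfl⟩ := hN.surjective_id_sub hsq (LinearMap.essential_ker_comp hc y) n
  rw [LinearMap.sub_apply, map_sub, LinearMap.comp_apply, hpz, hy', LinearMap.id_apply, sub_self]

/-- If `f : X → Y` is nonzero, the quotient of `N` by the kernel of `f` contains two independent
copies of the image of `f`, and then `N` maps onto a nonzero square. -/
theorem QuotientsAutInvariant.hom_eq_zero_of_disjoint [Module.Projective A N]
    (hN : QuotientsAutInvariant A N) (hsq : IsSquareFreeModule A N) {X Y : Submodule A N}
    (hXY : Disjoint X Y) (f : X →ₗ[A] Y) : f = 0 := by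
  set K := (LinearMap.ker f).map X.subtype with hK
  have hKX : K ≤ X := Submodule.map_subtype_le _ _
  have hKf : ∀ x : X, (x : N) ∈ K → f x = 0 := by
    rintro x ⟨y, hy, hyx⟩
    rwa [← Subtype.ext (a1 := y) (a2 := x) hyx]
  have hM := hN (N ⧸ K) K.mkQ K.mkQ_surjective
  let p : (X ⧸ LinearMap.ker f) →ₗ[A] N ⧸ K := (LinearMap.ker f).liftQ (K.mkQ ∘ₗ X.subtype)
    fun x hx ↦ by simpa [hK] using hx
  let q : (X ⧸ LinearMap.ker f) →ₗ[A] N ⧸ K := (LinearMap.ker f).liftQ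
    (K.mkQ ∘ₗ Y.subtype ∘ₗ f) fun x hx ↦ by simp [LinearMap.mem_ker.1 hx]
  have hpx : ∀ x : X, p ((LinearMap.ker f).mkQ x) = K.mkQ x := fun x ↦ rfl
  have hqx : ∀ x : X, q ((LinearMap.ker f).mkQ x) = K.mkQ (f x) := fun x ↦ rfl
  have hfX : ∀ x : X, (f x : N) ∈ X → f x = 0 := fun x hx ↦
    Subtype.ext (Submodule.disjoint_def.1 hXY _ hx (f x).2)
  have hp : Function.Injective p := by
    refine (injective_iff_map_eq_zero _).2 fun x hx ↦ ?_
    obtain ⟨x, rfl⟩ := (LinearMap.ker f).mkQ_surjective x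
    rw [hpx] at hx
    have h1 := hKf x (by simpa using hx)
    simpa using h1
  have hq : Function.Injective q := by
    refine (injective_iff_map_eq_zero _).2 fun x hx ↦ ?_
    obtain ⟨x, rfl⟩ := (LinearMap.ker f).mkQ_surjective x
    rw [hqx] at hx
    have h1 := hfX x (hKX (by simpa using hx))
    simpa using h1
  have hpq : Disjoint (LinearMap.range p) (LinearMap.range q) := by
    rw [Submodule.disjoint_def]
    rintro _ ⟨x, rfl⟩ ⟨y, hy⟩
    obtain ⟨x, rfl⟩ := (LinearMap.ker f).mkQ_surjective x
    obtain ⟨y, rfl⟩ := (LinearMap.ker f).mkQ_surjective y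
    rw [hqx, hpx] at hy
    have h1 : (f y : N) - x ∈ K := (Submodule.Quotient.eq K).1 hy
    have h2 := hfX y (by simpa using X.add_mem (hKX h1) x.2)
    rw [hpx, ← hy, h2, Submodule.coe_zero, map_zero]
  obtain ⟨a, b, haa, hbb, haba, hbab, hab⟩ := hM.exists_matrixUnits p q hp hq hpq
  have h0 : ∀ v : LinearMap.range (b ∘ₗ a), v = 0 := by
    let F := (b ∘ₗ a).rangeRestrict.prod (b.codRestrict (LinearMap.range (b ∘ₗ a))
      fun x ↦ ⟨b x, hbab x⟩)
    have hF : Function.Surjective F := by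
      rintro ⟨⟨_, x, rfl⟩, ⟨_, y, rfl⟩⟩
      refine ⟨b (a x) + a y, Prod.ext (Subtype.ext ?_) (Subtype.ext ?_)⟩
      · change b (a (b (a x) + a y)) = b (a x)
        rw [map_add, haba, haa, add_zero]
      · change b (b (a x) + a y) = b (a y)
        rw [map_add, hbb, zero_add]
    exact (hN N LinearMap.id Function.surjective_id).eq_zero_of_surjective_prod hsq (F ∘ₗ K.mkQ)
      (hF.comp K.mkQ_surjective)
  ext x
  have h1 : a (p ((LinearMap.ker f).mkQ x)) = 0 := by
    rw [← haba, show b (a (p ((LinearMap.ker f).mkQ x))) = 0 from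
      congrArg Subtype.val (h0 ⟨_, _, rfl⟩), map_zero]
  rw [(hab _).1] at h1
  have h2 : (LinearMap.ker f).mkQ x = 0 := hq (h1.trans (map_zero q).symm)
  have h3 : f x = 0 := by simpa using h2
  simp [h3]

end NoSquareQuotient

/-! ### Passage to corner rings -/

section Transfer

variable {A B M N : Type*} [Ring A] [Ring B] [AddCommGroup M] [Module A M] [AddCommGroup N]
  [Module B N] {σ : A →+* B}

/-- A linear map defined on a submodule is transported backwards along a bijective semilinear
map. -/
theorem LinearMap.exists_comap_of_bijective (l : M →ₛₗ[σ] N) (hl : Function.Bijective l)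
    [RingHomSurjective σ] (X : Submodule B N) (f : X →ₗ[B] N) :
    ∃ F : X.comap l →ₗ[A] M, ∀ x, l (F x) = f ⟨l x, x.2⟩ := by
  let k := Equiv.ofBijective l hl
  have hk : ∀ y, l (k.symm y) = y := k.apply_symm_apply
  refine ⟨⟨⟨fun x ↦ k.symm (f ⟨l x, x.2⟩), fun x y ↦ hl.1 ?_⟩, fun r x ↦ hl.1 ?_⟩, fun x ↦ hk _⟩
  · rw [map_add, hk, hk, hk, ← map_add]
    exact congrArg f (Subtype.ext (map_add l x.1 y.1))
  · simp only [RingHom.id_apply, LinearMap.map_smulₛₗ, hk]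
    rw [← map_smul]
    exact congrArg f (Subtype.ext (l.map_smulₛₗ r x.1))

theorem IsSquareFreeModule.of_bijective (hM : IsSquareFreeModule A M) (l : M →ₛₗ[σ] N)
    (hl : Function.Bijective l) [RingHomSurjective σ] : IsSquareFreeModule B N := by
  rintro ⟨X, Y, hX, -, hXY, ⟨e⟩⟩
  obtain ⟨F, hF⟩ := LinearMap.exists_comap_of_bijective l hl X (Y.subtype ∘ₗ e.toLinearMap)
  have hF' : ∀ x, l (F x) = e ⟨l x, x.2⟩ := hF
  have h0 := hM.eq_zero_of_injective (X.comap l).subtype F Subtype.val_injective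
    ((injective_iff_map_eq_zero _).2 fun x hx ↦ by
      have h1 := hF' x
      rw [hx, map_zero] at h1
      have h2 : e ⟨l x, x.2⟩ = 0 := Subtype.ext h1.symm
      have h3 : l x = 0 := congrArg Subtype.val (e.map_eq_zero_iff.1 h2)
      exact Subtype.ext (hl.1 (h3.trans (map_zero l).symm))) (by
      rw [Submodule.disjoint_def]
      rintro _ ⟨x, rfl⟩ ⟨y, hy⟩
      have h1 : l x ∈ X ⊓ Y := ⟨x.2, by
        have h2 : F y = x := hy
        rw [← h2, hF']
        exact (e _).2⟩
      rw [hXY, Submodule.mem_bot] at h1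
      exact hl.1 (h1.trans (map_zero l).symm))
  refine hX ((Submodule.eq_bot_iff X).2 fun x hx ↦ ?_)
  obtain ⟨m, rfl⟩ := hl.2 x
  have h1 : m = 0 := congrArg Subtype.val (h0 ⟨m, hx⟩)
  rw [h1, map_zero]

theorem LinearMap.eq_zero_of_disjoint_of_bijective
    (hM : ∀ X Y : Submodule A M, Disjoint X Y → ∀ f : X →ₗ[A] Y, f = 0) (l : M →ₛₗ[σ] N)
    (hl : Function.Bijective l) [RingHomSurjective σ] {X Y : Submodule B N} (hXY : Disjoint X Y)
    (f : X →ₗ[B] Y) : f = 0 := by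
  obtain ⟨F, hF⟩ := LinearMap.exists_comap_of_bijective l hl X (Y.subtype ∘ₗ f)
  have hF' : ∀ x, l (F x) = f ⟨l x, x.2⟩ := hF
  have h0 := hM (X.comap l) (Y.comap l) (Submodule.disjoint_def.2 fun x hx hy ↦
    hl.1 ((Submodule.disjoint_def.1 hXY _ hx hy).trans (map_zero l).symm))
    (F.codRestrict _ fun x ↦ by
      rw [Submodule.mem_comap, hF']
      exact (f _).2)
  ext ⟨x, hx⟩
  obtain ⟨m, rfl⟩ := hl.2 x
  have h1 : F ⟨m, hx⟩ = 0 := congrArg Subtype.val (LinearMap.congr_fun h0 ⟨m, hx⟩)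
  have h2 := hF' ⟨m, hx⟩
  rw [h1, map_zero] at h2
  exact h2.symm

end Transfer

section Corner

variable {R : Type u} [Ring R]

/-- Left multiplication by `r`, an endomorphism of the right module `R`. -/
def mulLeftOp (r : R) : R →ₗ[Rᵐᵒᵖ] R where
  toFun x := r * x
  map_add' := mul_add r
  map_smul' c x := (mul_assoc r x c.unop).symm

theorem mulLeftOp_apply (r x : R) : mulLeftOp r x = r * x := rfl

/-- The projection of a ring onto the corner of a central idempotent. -/
def IsIdempotentElem.toCorner {e : R} (he : IsIdempotentElem e) (hc : ∀ r, e * r = r * e) :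
    R →+* he.Corner where
  toFun r := ⟨e * r * e, r, rfl⟩
  map_one' := Subtype.ext (by
    change e * 1 * e = e
    rw [mul_one, he.eq])
  map_zero' := Subtype.ext (by
    change e * 0 * e = 0
    simp)
  map_add' r s := Subtype.ext (by
    change e * (r + s) * e = e * r * e + e * s * e
    rw [mul_add, add_mul])
  map_mul' r s := Subtype.ext (by
    change e * (r * s) * e = e * r * e * (e * s * e)
    have h : ∀ x, e * x * e = e * x := fun x ↦ by rw [mul_assoc, ← hc, ← mul_assoc, he.eq]
    rw [h, h, h, ← mul_assoc (e * r), h, mul_assoc])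

theorem IsIdempotentElem.toCorner_val {e : R} (he : IsIdempotentElem e) (hc : ∀ r, e * r = r * e)
    (r : R) : (he.toCorner hc r).1 = e * r := by
  change e * r * e = e * r
  rw [mul_assoc, ← hc, ← mul_assoc, he.eq]

theorem IsIdempotentElem.toCorner_surjective {e : R} (he : IsIdempotentElem e)
    (hc : ∀ r, e * r = r * e) : Function.Surjective (he.toCorner hc) := by
  rintro ⟨_, r, rfl⟩
  exact ⟨r, rfl⟩

/-- The right ideal `V = eR` of a central idempotent `e` is the right regular module of the corner
ring, along the projection onto the corner. -/
theorem IsIdempotentElem.exists_bijective_corner {e : R} (he : IsIdempotentElem e)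
    (hc : ∀ r, e * r = r * e) (V : Submodule Rᵐᵒᵖ R) (hV : ∀ x, x ∈ V ↔ e * x = x) :
    ∃ l : V →ₛₗ[(he.toCorner hc).op] he.Corner, Function.Bijective l := by
  refine ⟨⟨⟨fun x ↦ he.toCorner hc x, fun x y ↦ map_add _ _ _⟩, fun r x ↦ map_mul _ _ _⟩,
    fun x y hxy ↦ ?_, fun y ↦ ?_⟩
  · have h : (he.toCorner hc x).1 = (he.toCorner hc y).1 := congrArg Subtype.val hxy
    rw [he.toCorner_val, he.toCorner_val, (hV x).1 x.2, (hV y).1 y.2] at h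
    exact Subtype.ext h
  · obtain ⟨r, rfl⟩ := he.toCorner_surjective hc y
    refine ⟨⟨e * r, (hV _).2 (by rw [← mul_assoc, he.eq])⟩, Subtype.ext ?_⟩
    change (he.toCorner hc (e * r)).1 = _
    rw [he.toCorner_val, he.toCorner_val, ← mul_assoc, he.eq]

theorem IsIdempotentElem.nonempty_ringEquiv_corner_prod {e : R} (he : IsIdempotentElem e)
    (hc : ∀ r, e * r = r * e) : Nonempty (R ≃+* he.one_sub.Corner × he.Corner) := by
  have hc' : ∀ r, (1 - e) * r = r * (1 - e) := fun r ↦ by rw [sub_mul, mul_sub, hc]; simp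
  refine ⟨RingEquiv.ofBijective ((he.one_sub.toCorner hc').prod (he.toCorner hc)) ⟨?_, ?_⟩⟩
  · refine (injective_iff_map_eq_zero _).2 fun r hr ↦ ?_
    have h1 : (he.one_sub.toCorner hc' r).1 = 0 := congrArg (fun x ↦ x.1.1) hr
    have h2 : (he.toCorner hc r).1 = 0 := congrArg (fun x ↦ x.2.1) hr
    rw [toCorner_val] at h1 h2
    simpa [h2, sub_mul] using h1
  · rintro ⟨x, y⟩
    obtain ⟨r, rfl⟩ := he.one_sub.toCorner_surjective hc' x
    obtain ⟨s, rfl⟩ := he.toCorner_surjective hc y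
    have h : e * e = e := he
    refine ⟨(1 - e) * r + e * s, Prod.ext (Subtype.ext ?_) (Subtype.ext ?_)⟩
    · change (he.one_sub.toCorner hc' _).1 = _
      rw [toCorner_val, toCorner_val, mul_add, ← mul_assoc, ← mul_assoc, he.one_sub.eq,
        sub_mul 1 e e, h]
      simp
    · change (he.toCorner hc _).1 = _
      rw [toCorner_val, toCorner_val, mul_add, ← mul_assoc, ← mul_assoc, h, mul_sub, h]
      simp

theorem QuotientsAutInvariant.of_surjective {A N N' : Type u} [Ring A] [AddCommGroup N] [Module A N]
    [AddCommGroup N'] [Module A N'] (hN : QuotientsAutInvariant A N) (f : N →ₗ[A] N')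
    (hf : Function.Surjective f) : QuotientsAutInvariant A N' :=
  fun M _ _ g hg ↦ hN M (g ∘ₗ f) (hg.comp hf)

/-- If maps between independent right ideals vanish, then idempotents are central, because
`x ↦ (1 - e) s x` maps `eT` to `(1 - e)T`. -/
theorem IsIdempotentElem.mem_center_of_hom_eq_zero {T : Type*} [Ring T]
    (hT : ∀ X Y : Submodule Tᵐᵒᵖ T, Disjoint X Y → ∀ f : X →ₗ[Tᵐᵒᵖ] Y, f = 0) {e : T}
    (he : IsIdempotentElem e) : e ∈ Subring.center T := by
  have key : ∀ e : T, IsIdempotentElem e → ∀ s, (1 - e) * s * e = 0 := by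
    intro e he s
    have hdisj : Disjoint (LinearMap.range (mulLeftOp e))
        (LinearMap.range (mulLeftOp (1 - e))) := by
      rw [Submodule.disjoint_def]
      rintro _ ⟨x, rfl⟩ ⟨y, hy⟩
      simp only [mulLeftOp_apply] at hy ⊢
      have h1 : e * (e * x) = e * x := by rw [← mul_assoc, he.eq]
      rw [← h1, ← hy, ← mul_assoc, mul_sub, mul_one, he.eq, sub_self, zero_mul]
    have h0 := hT _ _ hdisj ((mulLeftOp ((1 - e) * s)).restrict fun x _ ↦
      ⟨s * x, (mul_assoc _ _ _).symm⟩)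
    exact congrArg Subtype.val (LinearMap.congr_fun h0 ⟨e, 1, mul_one e⟩)
  refine Subring.mem_center_iff.2 fun s ↦ ?_
  have h1 := key e he s
  have h2 := key (1 - e) he.one_sub s
  rw [sub_mul, one_mul, sub_mul] at h1
  rw [sub_sub_cancel, mul_sub, mul_one] at h2
  rw [sub_eq_zero.1 h1, ← sub_eq_zero.1 h2]

end Corner

theorem mainTheorem7 {R : Type u} [Ring R]
    (hR : ∀ (M : Type u) [AddCommGroup M] [Module Rᵐᵒᵖ M],
      IsCyclicModule Rᵐᵒᵖ M → IsAutomorphismInvariant Rᵐᵒᵖ M) :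
    ∃ (S T : Type u) (_ : Ring S) (_ : Ring T),
      Nonempty (R ≃+* S × T) ∧
      IsSemisimpleRing S ∧
      IsSquareFreeModule Tᵐᵒᵖ T ∧
      (∀ X Y : Submodule Tᵐᵒᵖ T, IsClosedSubmodule X → IsClosedSubmodule Y → X ⊓ Y = ⊥ →
        ∀ f : X →ₗ[Tᵐᵒᵖ] Y, f = 0) ∧
      (∀ e : T, IsIdempotentElem e → e ∈ Subring.center T) := by
  have hspan : ∀ x y : R, y ∈ Submodule.span Rᵐᵒᵖ {x} ↔ ∃ r, x * r = y := fun x y ↦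
    Submodule.mem_span_singleton.trans
      ⟨fun ⟨c, hc⟩ ↦ ⟨c.unop, hc⟩, fun ⟨r, hr⟩ ↦ ⟨MulOpposite.op r, hr⟩⟩
  have hN : QuotientsAutInvariant Rᵐᵒᵖ R := fun M _ _ f hf ↦ hR M ⟨f 1, by
    rw [eq_top_iff]
    intro y _
    obtain ⟨r, rfl⟩ := hf y
    exact Submodule.mem_span_singleton.2 ⟨MulOpposite.op r, by rw [← map_smul]; simp⟩⟩
  let k : Rᵐᵒᵖ ≃ₗ[Rᵐᵒᵖ] R :=
    { MulOpposite.opAddEquiv.symm with map_smul' := fun c x ↦ rfl }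
  have : Module.Finite Rᵐᵒᵖ R := Module.Finite.equiv k
  have : Module.Projective Rᵐᵒᵖ R := Module.Projective.of_equiv k
  have hgen : ∀ x : R, ∃ φ : R →ₗ[Rᵐᵒᵖ] R, LinearMap.range φ = Submodule.span Rᵐᵒᵖ {x} :=
    fun x ↦ ⟨mulLeftOp x, Submodule.ext fun y ↦ (hspan x y).symm⟩
  obtain ⟨g, hgg, hgc, hss, hsf⟩ := hN.exists_central_idempotent hgen
  -- The endomorphism `g` is left multiplication by a central idempotent `e`.
  obtain ⟨e, hge⟩ : ∃ e, ∀ x, g x = e * x := ⟨g 1, fun x ↦ by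
    have := g.map_smul (MulOpposite.op x) 1
    simpa using this⟩
  have he : IsIdempotentElem e := (by simpa [hge] using hgg 1 : e * e = e)
  have hc : ∀ r, e * r = r * e := fun r ↦ by
    simpa [hge, mulLeftOp_apply] using hgc (mulLeftOp r) 1
  have hc' : ∀ r, (1 - e) * r = r * (1 - e) := fun r ↦ by rw [sub_mul, mul_sub, hc]; simp
  obtain ⟨l, hl⟩ := he.exists_bijective_corner hc (LinearMap.range g) fun x ↦
    ⟨by rintro ⟨y, rfl⟩; rw [← hge, hgg], fun h ↦ ⟨x, (hge x).trans h⟩⟩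
  obtain ⟨l', hl'⟩ := he.one_sub.exists_bijective_corner hc' (LinearMap.ker g) fun x ↦ by
    rw [LinearMap.mem_ker, hge, sub_mul, one_mul, sub_eq_self]
  have hσ : RingHomSurjective (he.toCorner hc).op := ⟨fun x ↦ by
    obtain ⟨r, hr⟩ := he.toCorner_surjective hc x.unop
    exact ⟨MulOpposite.op r, congrArg MulOpposite.op hr⟩⟩
  have hσ' : RingHomSurjective (he.one_sub.toCorner hc').op := ⟨fun x ↦ by
    obtain ⟨r, hr⟩ := he.one_sub.toCorner_surjective hc' x.unop
    exact ⟨MulOpposite.op r, congrArg MulOpposite.op hr⟩⟩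
  have hproj : Module.Projective Rᵐᵒᵖ (LinearMap.range g) :=
    Submodule.HasProjection.projective ⟨g, fun x ↦ ⟨x, rfl⟩, by rintro _ ⟨x, rfl⟩; exact hgg x⟩
  have hT : ∀ X Y : Submodule he.Cornerᵐᵒᵖ he.Corner, Disjoint X Y →
      ∀ f : X →ₗ[he.Cornerᵐᵒᵖ] Y, f = 0 := fun X Y hXY f ↦
    LinearMap.eq_zero_of_disjoint_of_bijective (fun X Y hXY f ↦
      (hN.of_surjective g.rangeRestrict g.surjective_rangeRestrict).hom_eq_zero_of_disjoint
        hsf hXY f)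
      l hl hXY f
  refine ⟨he.one_sub.Corner, he.Corner, inferInstance, inferInstance,
    he.nonempty_ringEquiv_corner_prod hc, ?_, hsf.of_bijective l hl,
    fun X Y _ _ hXY f ↦ hT X Y (disjoint_iff.2 hXY) f,
    fun e' he' ↦ he'.mem_center_of_hom_eq_zero hT⟩
  -- The corner is semisimple as a right module over itself.
  have hS := (LinearMap.isSemisimpleModule_iff_of_bijective l' hl').1 hss
  let k' : he.one_sub.Cornerᵐᵒᵖ ≃ₗ[he.one_sub.Cornerᵐᵒᵖ] he.one_sub.Corner :=
    { MulOpposite.opAddEquiv.symm with map_smul' := fun c x ↦ rfl }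
  exact isSemisimpleRing_mulOpposite_iff.1 (IsSemisimpleModule.congr k')
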